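/- Let $d\ge 1$, let $X_1,X_2,\dots$ be independent and identically distributed random variables with values in $\mathbb R^d$ and common distribution $\mu$, and let $\mu_k=\frac1k\sum_{i=1}^k\delta_{X_i}$ for $k\ge1$. For real $p\ge 1$ and probability measures $\nu_1,\nu_2$ on $\mathbb R^d$, let $$W_p^p(\nu_1,\nu_2)=\inf_{\pi\in\Pi(\nu_1,\nu_2)}\int_{\mathbb R^d\times\mathbb R^d}|x-y|_2^p\,\pi(dx,dy),$$ where $|\cdot|_2$ is the Euclidean norm and $\Pi(\nu_1,\nu_2)$ is the set of probability measures on $\mathbb R^d\times\mathbb R^d$ with margins $\nu_1$ and $\nu_2$. Let $p\ge1$ and $r\in(1,2)$ be such that $\|X\|_{rp}^{rp}:=\int_{\mathbb R^d}\max(|y_1|,\dots,|y_d|)^{rp}\,\mu(dy)<\infty$. Then, for every $x>0$: 1. If $p>d(r-1)/r$ and $1/r\le\alpha\le1$, then $$\sum_{n=1}^\infty n^{\alpha r-2}\,\mathbb P\Big(\max_{1\le k\le n}kW_p^p(\mu_k,\mu)>n^\alpha x\Big)<\infty.$$ 2. If $p<d(r-1)/r$ and $(d-p)/d<\alpha\le1$,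 then $$\sum_{n=1}^\infty n^{(pr-(1-\alpha)rd-d)/d}\,\mathbb P\Big(\max_{1\le k\le n}kW_p^p(\mu_k,\mu)>n^\alpha x\Big)<\infty.$$ 3. If $p<d(r-1)/r$, then $$\sum_{n=1}^\infty \frac1n\,\mathbb P\Big(\max_{1\le k\le n}kW_p^p(\mu_k,\mu)>n^{(d-p)/d}(\log n)^{1/r}x\Big)<\infty.$$ -/

import Mathlib

open MeasureTheory ProbabilityTheory
open scoped ENNReal

/-- The couplings of `ν₁` and `ν₂`: probability measures on the product space with margins
`ν₁` and `ν₂`. -/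
def couplings {d : ℕ} (ν₁ ν₂ : Measure (EuclideanSpace ℝ (Fin d))) :
    Set (Measure (EuclideanSpace ℝ (Fin d) × EuclideanSpace ℝ (Fin d))) :=
  {π | IsProbabilityMeasure π ∧ π.map Prod.fst = ν₁ ∧ π.map Prod.snd = ν₂}

/-- The `p`-th power `W_p^p(ν₁, ν₂)` of the Wasserstein distance of order `p` for the Euclidean
distance on `ℝ^d`: the infimum over all couplings `π` of the integral of `|x - y|₂ ^ p`. -/
noncomputable def wassersteinPow {d : ℕ} (p : ℝ)
    (ν₁ ν₂ : Measure (EuclideanSpace ℝ (Fin d))) : ℝ≥0∞ :=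
  ⨅ π ∈ couplings ν₁ ν₂, ∫⁻ z, edist z.1 z.2 ^ p ∂π

/-- The empirical measure `μ_k = (1/k) ∑ δ_{X_i}` of the first `k` terms of the sequence `X`
(indexed from `0`), at the sample point `ω`; meaningful for `k ≥ 1`. -/
noncomputable def empiricalMeasure {d : ℕ} {Ω : Type*} (X : ℕ → Ω → EuclideanSpace ℝ (Fin d))
    (k : ℕ) (ω : Ω) : Measure (EuclideanSpace ℝ (Fin d)) :=
  (k : ℝ≥0∞)⁻¹ • ∑ i ∈ Finset.range k, Measure.dirac (X i ω)

/-- `max_{1 ≤ k ≤ n} k W_p^p(μ_k, μ)` at the sample point `ω`. -/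
noncomputable def maxWassersteinPow {d : ℕ} {Ω : Type*} (p : ℝ)
    (μ : Measure (EuclideanSpace ℝ (Fin d))) (X : ℕ → Ω → EuclideanSpace ℝ (Fin d))
    (n : ℕ) (ω : Ω) : ℝ≥0∞ :=
  (Finset.Icc 1 n).sup fun k => (k : ℝ≥0∞) * wassersteinPow p (empiricalMeasure X k ω) μ

/-- The strong moment `‖X‖_q^q = ∫ |y|^q dμ(y)` of a random vector with law `μ`, where
`|y| = max (|y_1|, …, |y_d|)` (the norm of `Fin d → ℝ` is the maximum norm). -/
noncomputable def strongMoment {d : ℕ} (q : ℝ) (μ : Measure (EuclideanSpace ℝ (Fin d))) : ℝ≥0∞ :=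
  ∫⁻ y, ‖(WithLp.ofLp y : Fin d → ℝ)‖ₑ ^ q ∂μ

/-- Greedy coupling along a countable partition: in every cell of the partition, as much mass as
possible is transported. -/
lemma exists_cellwise_coupling {E κ : Type*} [MeasurableSpace E] [MeasurableSpace κ]
    [Countable κ] [MeasurableSingletonClass κ] (μ ν : Measure E) [IsFiniteMeasure μ]
    [IsFiniteMeasure ν] (g : E → κ) (hg : Measurable g) :
    ∃ (η : Measure (E × E)) (μ' ν' : Measure E),
      η.map Prod.fst + μ' = μ ∧ η.map Prod.snd + ν' = ν ∧
      (∀ c, μ' (g ⁻¹' {c}) = μ (g ⁻¹' {c}) - ν (g ⁻¹' {c})) ∧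
      (∀ c, ν' (g ⁻¹' {c}) = ν (g ⁻¹' {c}) - μ (g ⁻¹' {c})) ∧
      ∀ᵐ z ∂η, g z.1 = g z.2 := by
  classical
  set a : κ → ℝ≥0∞ := fun c => μ (g ⁻¹' {c}) with ha
  set b : κ → ℝ≥0∞ := fun c => ν (g ⁻¹' {c}) with hb
  have ha_top : ∀ c, a c ≠ ∞ := fun c => measure_ne_top _ _
  have hb_top : ∀ c, b c ≠ ∞ := fun c => measure_ne_top _ _
  have hcell : ∀ c, MeasurableSet (g ⁻¹' {c}) := fun c => hg (measurableSet_singleton c)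
  let φ : κ → ℝ≥0∞ := fun c => min (a c) (b c) * (a c)⁻¹ * (b c)⁻¹
  have hφm : Measurable φ := measurable_of_countable φ
  let ρ : E × E → ℝ≥0∞ := fun z => if g z.1 = g z.2 then φ (g z.1) else 0
  have hset : MeasurableSet {z : E × E | g z.1 = g z.2} :=
    measurableSet_eq_fun (hg.comp measurable_fst) (hg.comp measurable_snd)
  have hρm : Measurable ρ := Measurable.ite hset (hφm.comp (hg.comp measurable_fst)) measurable_const
  -- the densities of the two margins
  have hu : ∀ c, φ c * b c ≤ 1 ∧ (φ c * b c) * a c = min (a c) (b c) := by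
    intro c
    rcases eq_or_ne (b c) 0 with h0 | h0
    · simp [φ, h0]
    rcases eq_or_ne (a c) 0 with h1 | h1
    · simp [φ, h1]
    have e : φ c * b c = min (a c) (b c) * (a c)⁻¹ := by
      simp only [φ]
      rw [mul_assoc, ENNReal.inv_mul_cancel h0 (hb_top c), mul_one]
    rw [e]
    refine ⟨?_, ?_⟩
    · calc _ ≤ a c * (a c)⁻¹ := by gcongr; exact min_le_left _ _
        _ ≤ 1 := ENNReal.mul_inv_le_one _
    · rw [mul_assoc, ENNReal.inv_mul_cancel h1 (ha_top c), mul_one]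
  have hv : ∀ c, φ c * a c ≤ 1 ∧ (φ c * a c) * b c = min (a c) (b c) := by
    intro c
    rcases eq_or_ne (a c) 0 with h0 | h0
    · simp [φ, h0]
    rcases eq_or_ne (b c) 0 with h1 | h1
    · simp [φ, h1]
    have e : φ c * a c = min (a c) (b c) * (b c)⁻¹ := by
      simp only [φ]
      rw [mul_right_comm, mul_assoc (min _ _), ENNReal.inv_mul_cancel h0 (ha_top c), mul_one]
    rw [e]
    refine ⟨?_, ?_⟩
    · calc _ ≤ b c * (b c)⁻¹ := by gcongr; exact min_le_right _ _
        _ ≤ 1 := ENNReal.mul_inv_le_one _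
    · rw [mul_assoc, ENNReal.inv_mul_cancel h1 (hb_top c), mul_one]
  have key : ∀ (τ : Measure E) (u : κ → ℝ≥0∞), (∀ c, u c ≤ 1) →
      τ.withDensity (fun x => u (g x)) + τ.withDensity (fun x => 1 - u (g x)) = τ := by
    intro τ u h1
    have hum : Measurable u := measurable_of_countable u
    change τ.withDensity (u ∘ g) + τ.withDensity (fun x => 1 - u (g x)) = τ
    rw [← withDensity_add_left (hum.comp hg)]
    conv_rhs => rw [← withDensity_one (μ := τ)]
    congr 1
    funext x
    simp [add_tsub_cancel_of_le (h1 (g x))]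
  have key2 : ∀ (τ : Measure E) [IsFiniteMeasure τ] (u : κ → ℝ≥0∞) (c : κ), (u c ≤ 1) →
      τ.withDensity (fun x => 1 - u (g x)) (g ⁻¹' {c})
        = τ (g ⁻¹' {c}) - u c * τ (g ⁻¹' {c}) := by
    intro τ _ u c h1
    rw [withDensity_apply _ (hcell c)]
    rw [setLIntegral_congr_fun (g := fun _ => 1 - u c) (hcell c)
      (by intro x hx; simp only [Set.mem_preimage, Set.mem_singleton_iff] at hx; simp [hx])]
    rw [setLIntegral_const, ENNReal.sub_mul (by intros; exact measure_ne_top _ _), one_mul]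
  have hcellsum : ∀ x, ∀ τ : Measure E, ∫⁻ y, (if g x = g y then φ (g x) else 0) ∂τ
      = φ (g x) * τ (g ⁻¹' {g x}) := by
    intro x τ
    have : (fun y => if g x = g y then φ (g x) else 0)
        = (g ⁻¹' {g x}).indicator (fun _ => φ (g x)) := by
      funext y; simp [Set.indicator, eq_comm]
    rw [this, lintegral_indicator_const (hcell _)]
  refine ⟨(μ.prod ν).withDensity ρ, μ.withDensity (fun x => 1 - φ (g x) * b (g x)),
    ν.withDensity (fun x => 1 - φ (g x) * a (g x)), ?_, ?_, ?_, ?_, ?_⟩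
  · conv_rhs => rw [← key μ (fun c => φ c * b c) (fun c => (hu c).1)]
    congr 1
    ext s hs
    rw [Measure.map_apply measurable_fst hs, withDensity_apply _ (measurable_fst hs),
      withDensity_apply _ hs, ← lintegral_indicator (measurable_fst hs), lintegral_prod _
        (hρm.indicator (measurable_fst hs)).aemeasurable, ← lintegral_indicator hs]
    refine lintegral_congr fun x => ?_
    by_cases hx : x ∈ s
    · simp only [Set.indicator, Set.mem_preimage, hx, if_true, ρ]
      exact hcellsum x ν
    · simp [Set.indicator, hx]
  · conv_rhs => rw [← key ν (fun c => φ c * a c) (fun c => (hv c).1)]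
    congr 1
    ext s hs
    rw [Measure.map_apply measurable_snd hs, withDensity_apply _ (measurable_snd hs),
      withDensity_apply _ hs, ← lintegral_indicator (measurable_snd hs), lintegral_prod_symm _
        (hρm.indicator (measurable_snd hs)).aemeasurable, ← lintegral_indicator hs]
    refine lintegral_congr fun x => ?_
    by_cases hx : x ∈ s
    · simp only [Set.indicator, Set.mem_preimage, hx, if_true, ρ]
      rw [← hcellsum x μ]
      refine lintegral_congr fun y => ?_
      by_cases h : g y = g x
      · simp [h]
      · simp [h, Ne.symm h]
    · simp [Set.indicator, hx]
  · intro c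
    rw [key2 μ (fun c => φ c * b c) c (hu c).1]
    change a c - φ c * b c * a c = a c - b c
    rw [(hu c).2]
    rcases le_total (a c) (b c) with h | h <;> simp [h, tsub_eq_zero_of_le]
  · intro c
    rw [key2 ν (fun c => φ c * a c) c (hv c).1]
    change b c - φ c * a c * b c = b c - a c
    rw [(hv c).2]
    rcases le_total (a c) (b c) with h | h <;> simp [h, tsub_eq_zero_of_le]
  · rw [ae_withDensity_iff hρm]
    refine Filter.Eventually.of_forall fun z hz => ?_
    by_contra hne
    exact hz (if_neg hne)

/-- A coupling built greedily along a refining sequence of partitions, from the finest one to the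
coarsest one. -/
theorem exists_multilevel_coupling {E κ : Type*} [MeasurableSpace E] [MeasurableSpace κ]
    [Countable κ] [MeasurableSingletonClass κ] (g : ℕ → E → κ) (hg : ∀ l, Measurable (g l))
    (hrefine : ∀ l x y, g (l + 1) x = g (l + 1) y → g l x = g l y)
    (cost : E × E → ℝ≥0∞) (D : E → ℝ≥0∞) (hD : Measurable D) (C : ℕ → ℝ≥0∞)
    (hroot : ∀ x y, cost (x, y) ≤ C 0 * (D x + D y))
    (hlevel : ∀ l x y, g l x = g l y → cost (x, y) ≤ C (l + 1) * (D x + D y))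
    (O : Set E) (hO : MeasurableSet O) (F : ℕ → Finset κ) (δ : κ → ℝ≥0∞)
    (hcov : ∀ l, ∀ x ∉ O, g l x ∈ F l ∧ D x ≤ δ (g l x)) (N : ℕ) :
    ∀ (μ ν : Measure E) [IsFiniteMeasure μ] [IsFiniteMeasure ν], μ Set.univ = ν Set.univ →
      ∃ η : Measure (E × E), η.map Prod.fst = μ ∧ η.map Prod.snd = ν ∧
        ∫⁻ z, cost z ∂η ≤ C N * (∫⁻ x, D x ∂μ + ∫⁻ x, D x ∂ν) +
          ∑ l ∈ Finset.range N, C l * (∫⁻ x in O, D x ∂μ + ∫⁻ x in O, D x ∂ν +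
            ∑ c ∈ F l, δ c * ((μ (g l ⁻¹' {c}) - ν (g l ⁻¹' {c})) +
              (ν (g l ⁻¹' {c}) - μ (g l ⁻¹' {c})))) := by
  have hcost : ∀ (η : Measure (E × E)) (μ ν : Measure E) (c : ℝ≥0∞), η.map Prod.fst ≤ μ →
      η.map Prod.snd ≤ ν → (∀ᵐ z ∂η, cost z ≤ c * (D z.1 + D z.2)) →
      ∫⁻ z, cost z ∂η ≤ c * (∫⁻ x, D x ∂μ + ∫⁻ x, D x ∂ν) := by
    intro η μ ν c h1 h2 h
    calc ∫⁻ z, cost z ∂η ≤ ∫⁻ z, c * (D z.1 + D z.2) ∂η := lintegral_mono_ae h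
      _ = c * (∫⁻ x, D x ∂(η.map Prod.fst) + ∫⁻ x, D x ∂(η.map Prod.snd)) := by
        rw [lintegral_const_mul _ (by fun_prop), lintegral_add_left (by fun_prop),
          lintegral_map hD measurable_fst, lintegral_map hD measurable_snd]
      _ ≤ _ := by gcongr
  have hrest : ∀ (l : ℕ) (μ μ' : Measure E), μ' ≤ μ →
      ∫⁻ x, D x ∂μ' ≤ ∫⁻ x in O, D x ∂μ + ∑ c ∈ F l, δ c * μ' (g l ⁻¹' {c}) := by
    intro l μ μ' hle
    rw [← lintegral_add_compl D hO]
    gcongr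
    have hcell : ∀ c, MeasurableSet (g l ⁻¹' {c}) := fun c => hg l (measurableSet_singleton c)
    calc ∫⁻ x in Oᶜ, D x ∂μ'
        ≤ ∫⁻ x in Oᶜ, ∑ c ∈ F l, (g l ⁻¹' {c}).indicator (fun _ => δ c) x ∂μ' := by
          refine setLIntegral_mono' hO.compl fun x hx => ?_
          obtain ⟨h1, h2⟩ := hcov l x hx
          refine h2.trans ?_
          refine le_trans (by simp) (Finset.single_le_sum
            (f := fun c => (g l ⁻¹' {c}).indicator (fun _ => δ c) x) (fun _ _ => zero_le) h1)
      _ ≤ ∫⁻ x, ∑ c ∈ F l, (g l ⁻¹' {c}).indicator (fun _ => δ c) x ∂μ' :=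
          setLIntegral_le_lintegral _ _
      _ = _ := by
        rw [lintegral_finsetSum _ (fun c _ => measurable_const.indicator (hcell c))]
        simp [hcell]
  have hrefine' : ∀ n, ∀ l ≤ n, ∀ x y, g n x = g n y → g l x = g l y := by
    intro n l hl x y
    induction n, hl using Nat.le_induction with
    | base => exact id
    | succ n hn ih => exact fun h => ih (hrefine n x y h)
  induction N with
  | zero =>
    intro μ ν _ _ hmass
    obtain ⟨η, μ', ν', h1, h2, h3, h4, -⟩ :=
      exists_cellwise_coupling μ ν (fun _ => ()) measurable_const
    have hμ' : μ' = 0 := by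
      have := h3 ()
      rw [← Measure.measure_univ_eq_zero]
      simpa [hmass] using this
    have hν' : ν' = 0 := by
      have := h4 ()
      rw [← Measure.measure_univ_eq_zero]
      simpa [hmass] using this
    subst hμ' hν'
    rw [add_zero] at h1 h2
    refine ⟨η, h1, h2, ?_⟩
    simpa using hcost η μ ν (C 0) h1.le h2.le (Filter.Eventually.of_forall fun z => hroot z.1 z.2)
  | succ N ih =>
    intro μ ν _ _ hmass
    obtain ⟨η, μ', ν', h1, h2, h3, h4, h5⟩ := exists_cellwise_coupling μ ν (g N) (hg N)
    have hle1 : η.map Prod.fst ≤ μ := by conv_rhs => rw [← h1]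
                                         exact Measure.le_add_right le_rfl
    have hle2 : η.map Prod.snd ≤ ν := by conv_rhs => rw [← h2]
                                         exact Measure.le_add_right le_rfl
    have hle1' : μ' ≤ μ := by conv_rhs => rw [← h1]
                              exact Measure.le_add_left le_rfl
    have hle2' : ν' ≤ ν := by conv_rhs => rw [← h2]
                              exact Measure.le_add_left le_rfl
    have : IsFiniteMeasure μ' := isFiniteMeasure_of_le μ hle1'
    have : IsFiniteMeasure ν' := isFiniteMeasure_of_le ν hle2'
    have : IsFiniteMeasure (η.map Prod.fst) := isFiniteMeasure_of_le μ hle1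
    -- both margins of `η` give the same mass to unions of cells
    have hsub : ∀ s : Set E, MeasurableSet s → (∀ x y, g N x = g N y → (x ∈ s ↔ y ∈ s)) →
        μ s - ν s = μ' s - ν' s ∧ ν s - μ s = ν' s - μ' s := by
      intro s hs hsat
      have e : (η.map Prod.fst) s = (η.map Prod.snd) s := by
        rw [Measure.map_apply measurable_fst hs, Measure.map_apply measurable_snd hs]
        refine measure_congr ?_
        filter_upwards [h5] with z hz
        exact propext (hsat z.1 z.2 hz)
      have e1 : μ s = (η.map Prod.fst) s + μ' s := by conv_lhs => rw [← h1]
                                                      rfl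
      have e2 : ν s = (η.map Prod.fst) s + ν' s := by conv_lhs => rw [← h2]
                                                      rw [e]; rfl
      rw [e1, e2]
      have := measure_ne_top (η.map Prod.fst) s
      exact ⟨ENNReal.add_sub_add_eq_sub_left this, ENNReal.add_sub_add_eq_sub_left this⟩
    have hmass' : μ' Set.univ = ν' Set.univ := by
      have := hsub Set.univ MeasurableSet.univ (by simp)
      rw [hmass, tsub_self] at this
      exact le_antisymm (tsub_eq_zero_iff_le.1 this.1.symm) (tsub_eq_zero_iff_le.1 this.2.symm)
    obtain ⟨η', k1, k2, k3⟩ := ih μ' ν' hmass'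
    refine ⟨η + η', ?_, ?_, ?_⟩
    · rw [Measure.map_add _ _ measurable_fst, k1, h1]
    · rw [Measure.map_add _ _ measurable_snd, k2, h2]
    rw [lintegral_add_measure, Finset.sum_range_succ]
    have b0 : ∫⁻ z, cost z ∂η ≤ C (N + 1) * (∫⁻ x, D x ∂μ + ∫⁻ x, D x ∂ν) :=
      hcost η μ ν _ hle1 hle2 (by filter_upwards [h5] with z hz using hlevel N z.1 z.2 hz)
    have b1 : ∫⁻ x, D x ∂μ' + ∫⁻ x, D x ∂ν' ≤ ∫⁻ x in O, D x ∂μ + ∫⁻ x in O, D x ∂ν +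
            ∑ c ∈ F N, δ c * ((μ (g N ⁻¹' {c}) - ν (g N ⁻¹' {c})) +
              (ν (g N ⁻¹' {c}) - μ (g N ⁻¹' {c}))) := by
      refine (add_le_add (hrest N μ μ' hle1') (hrest N ν ν' hle2')).trans (le_of_eq ?_)
      simp only [h3, h4, mul_add, Finset.sum_add_distrib]
      ring
    have b2 : ∑ l ∈ Finset.range N, C l * (∫⁻ x in O, D x ∂μ' + ∫⁻ x in O, D x ∂ν' +
            ∑ c ∈ F l, δ c * ((μ' (g l ⁻¹' {c}) - ν' (g l ⁻¹' {c})) +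
              (ν' (g l ⁻¹' {c}) - μ' (g l ⁻¹' {c})))) ≤
        ∑ l ∈ Finset.range N, C l * (∫⁻ x in O, D x ∂μ + ∫⁻ x in O, D x ∂ν +
            ∑ c ∈ F l, δ c * ((μ (g l ⁻¹' {c}) - ν (g l ⁻¹' {c})) +
              (ν (g l ⁻¹' {c}) - μ (g l ⁻¹' {c})))) := by
      refine Finset.sum_le_sum fun l hl => mul_le_mul_right (add_le_add (by gcongr)
        (Finset.sum_le_sum fun c _ => ?_)) _
      have hs := hsub (g l ⁻¹' {c}) (hg l (measurableSet_singleton c)) (by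
        intro x y hxy
        simp [hrefine' N l (Finset.mem_range.1 hl).le x y hxy])
      rw [hs.1, hs.2]
    refine (add_le_add b0 (k3.trans (add_le_add (mul_le_mul_right b1 _) b2))).trans ?_
    rw [add_comm (Finset.sum _ _)]

/-- The index `m` of the dyadic shell `2 ^ (m - 1) < |x|_∞ ≤ 2 ^ m` (roughly) containing `x`. -/
noncomputable def dyadicShell {d : ℕ} (x : EuclideanSpace ℝ (Fin d)) : ℕ :=
  Nat.clog 2 ⌈‖(WithLp.ofLp x : Fin d → ℝ)‖⌉₊

/-- The index of the cell of `x` in the partition of level `l`: the dyadic shell of `x` together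
with the cube of relative side length `2 ^ (-l)` containing `x`. -/
noncomputable def dyadicCell {d : ℕ} (l : ℕ) (x : EuclideanSpace ℝ (Fin d)) :
    ℕ × (Fin d → ℤ) :=
  (dyadicShell x, fun i => ⌊2 ^ l * (x i / 2 ^ dyadicShell x)⌋)

/-- The possible positions of the cubes of level `l` in a dyadic shell. -/
noncomputable def dyadicBox (d l : ℕ) : Finset (Fin d → ℤ) :=
  Fintype.piFinset fun _ => Finset.Icc (-(2 ^ l)) (2 ^ l)

/-- The moment weight `2 ^ (p m)`, with `m` the dyadic shell of the point. -/
noncomputable def shellWeight {d : ℕ} (p : ℝ) (x : EuclideanSpace ℝ (Fin d)) : ℝ :=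
  2 ^ (p * dyadicShell x)

lemma measurable_dyadicShell {d : ℕ} :
    Measurable (dyadicShell : EuclideanSpace ℝ (Fin d) → ℕ) := by
  unfold dyadicShell
  refine (measurable_from_nat (f := fun n => Nat.clog 2 n)).comp (Nat.measurable_ceil.comp ?_)
  exact (PiLp.continuous_ofLp 2 _).norm.measurable

lemma measurable_shellWeight {d : ℕ} (p : ℝ) :
    Measurable (shellWeight p : EuclideanSpace ℝ (Fin d) → ℝ) :=
  (measurable_from_nat (f := fun n : ℕ => (2 : ℝ) ^ (p * n))).comp measurable_dyadicShell

lemma measurable_dyadicCell {d : ℕ} (l : ℕ) :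
    Measurable (dyadicCell l : EuclideanSpace ℝ (Fin d) → ℕ × (Fin d → ℤ)) := by
  refine measurable_dyadicShell.prodMk (measurable_pi_lambda _ fun i => ?_)
  refine Int.measurable_floor.comp (measurable_const.mul (Measurable.div ?_ ?_))
  · fun_prop
  · exact (measurable_from_nat (f := fun n : ℕ => (2 : ℝ) ^ n)).comp measurable_dyadicShell

lemma shellWeight_pos {d : ℕ} (p : ℝ) (x : EuclideanSpace ℝ (Fin d)) : 0 < shellWeight p x := by
  unfold shellWeight; positivity

lemma one_le_shellWeight {d : ℕ} {p : ℝ} (hp : 0 ≤ p) (x : EuclideanSpace ℝ (Fin d)) :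
    1 ≤ shellWeight p x :=
  Real.one_le_rpow (by norm_num) (by positivity)

lemma abs_apply_le_two_pow_dyadicShell {d : ℕ} (x : EuclideanSpace ℝ (Fin d)) (i : Fin d) :
    |x i| ≤ 2 ^ dyadicShell x := by
  calc |x i| ≤ ‖(WithLp.ofLp x : Fin d → ℝ)‖ := norm_le_pi_norm (WithLp.ofLp x : Fin d → ℝ) i
    _ ≤ (⌈‖(WithLp.ofLp x : Fin d → ℝ)‖⌉₊ : ℝ) := Nat.le_ceil _
    _ ≤ 2 ^ dyadicShell x := by
      exact_mod_cast Nat.le_pow_clog (by norm_num) _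

lemma two_pow_dyadicShell_le {d : ℕ} (x : EuclideanSpace ℝ (Fin d)) :
    (2 : ℝ) ^ dyadicShell x ≤ 2 * (‖(WithLp.ofLp x : Fin d → ℝ)‖ + 1) := by
  set a := ‖(WithLp.ofLp x : Fin d → ℝ)‖ with ha
  have ha0 : 0 ≤ a := norm_nonneg _
  rcases Nat.lt_or_ge 1 ⌈a⌉₊ with h | h
  · have h1 : 2 ^ (Nat.clog 2 ⌈a⌉₊).pred < ⌈a⌉₊ := Nat.pow_pred_clog_lt_self (by norm_num) h
    have h2 : 0 < Nat.clog 2 ⌈a⌉₊ := Nat.clog_pos (by norm_num) h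
    have h3 : 2 ^ (Nat.clog 2 ⌈a⌉₊) = 2 * 2 ^ (Nat.clog 2 ⌈a⌉₊).pred := by
      conv_lhs => rw [← Nat.succ_pred_eq_of_pos h2]
      rw [pow_succ, mul_comm]
    have h4 : (2 : ℝ) ^ dyadicShell x ≤ 2 * (⌈a⌉₊ : ℝ) := by
      unfold dyadicShell
      rw [← ha]
      exact_mod_cast (by omega : 2 ^ (Nat.clog 2 ⌈a⌉₊) ≤ 2 * ⌈a⌉₊)
    have := Nat.ceil_lt_add_one ha0
    linarith
  · have : dyadicShell x = 0 := by
      unfold dyadicShell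
      exact Nat.clog_of_right_le_one h 2
    rw [this]
    linarith [pow_zero (2 : ℝ)]

lemma euclidean_norm_le_of_forall_abs_le {d : ℕ} (x : EuclideanSpace ℝ (Fin d)) {M : ℝ}
    (hM : 0 ≤ M) (h : ∀ i, |x i| ≤ M) : ‖x‖ ≤ d * M := by
  rw [EuclideanSpace.norm_eq]
  refine Real.sqrt_le_iff.2 ⟨by positivity, ?_⟩
  calc ∑ i, ‖x i‖ ^ 2 ≤ ∑ _i : Fin d, M ^ 2 :=
        Finset.sum_le_sum fun i _ => pow_le_pow_left₀ (norm_nonneg _) (h i) 2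
    _ = d * M ^ 2 := by simp
    _ ≤ (d * d) * M ^ 2 := by
      gcongr
      exact_mod_cast Nat.le_mul_self d
    _ = (d * M) ^ 2 := by ring

lemma two_rpow_mul_natCast (p : ℝ) (m : ℕ) : (2 : ℝ) ^ (p * m) = ((2 : ℝ) ^ m) ^ p := by
  rw [mul_comm, Real.rpow_natCast_mul (by norm_num)]

lemma shellWeight_rpow {d : ℕ} (p r : ℝ) (x : EuclideanSpace ℝ (Fin d)) :
    shellWeight p x ^ r = shellWeight (r * p) x := by
  unfold shellWeight
  rw [← Real.rpow_mul (by norm_num)]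
  ring_nf

lemma dyadicCell_eq_of_succ {d : ℕ} (l : ℕ) (x y : EuclideanSpace ℝ (Fin d))
    (h : dyadicCell (l + 1) x = dyadicCell (l + 1) y) : dyadicCell l x = dyadicCell l y := by
  have key : ∀ z : EuclideanSpace ℝ (Fin d), dyadicCell l z =
      ((dyadicCell (l + 1) z).1, fun i => (dyadicCell (l + 1) z).2 i / 2) := by
    intro z
    unfold dyadicCell
    congr 1
    funext i
    have := Int.floor_div_natCast (2 ^ (l + 1) * (z i / 2 ^ dyadicShell z)) 2
    push_cast at this
    rw [← this]
    congr 1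
    ring
  rw [key x, key y, h]

lemma dist_rpow_le_shellWeight {d : ℕ} {p : ℝ} (hp : 0 ≤ p) (x y : EuclideanSpace ℝ (Fin d)) :
    dist x y ^ p ≤ (4 * d) ^ p * (shellWeight p x + shellWeight p y) := by
  set M := max ((2 : ℝ) ^ dyadicShell x) (2 ^ dyadicShell y) with hM
  have hM0 : 0 ≤ M := le_trans (by positivity) (le_max_left _ _)
  have h1 : dist x y ≤ d * (2 * M) := by
    rw [dist_eq_norm]
    refine euclidean_norm_le_of_forall_abs_le _ (by positivity) fun i => ?_
    have hx := (abs_apply_le_two_pow_dyadicShell x i).trans (le_max_left _ (2 ^ dyadicShell y))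
    have hy := (abs_apply_le_two_pow_dyadicShell y i).trans (le_max_right (2 ^ dyadicShell x) _)
    have := abs_sub (x i) (y i)
    simp only [PiLp.sub_apply]
    linarith
  calc dist x y ^ p ≤ (d * (2 * M)) ^ p := Real.rpow_le_rpow dist_nonneg h1 hp
    _ ≤ ((4 * d) * M) ^ p := by
      refine Real.rpow_le_rpow (by positivity) ?_ hp
      nlinarith [mul_nonneg (Nat.cast_nonneg (α := ℝ) d) hM0]
    _ = (4 * d) ^ p * M ^ p := Real.mul_rpow (by positivity) hM0
    _ ≤ _ := by
      gcongr
      unfold shellWeight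
      rw [two_rpow_mul_natCast, two_rpow_mul_natCast]
      have ha : 0 ≤ ((2 : ℝ) ^ dyadicShell x) ^ p := by positivity
      have hb : 0 ≤ ((2 : ℝ) ^ dyadicShell y) ^ p := by positivity
      rcases max_choice ((2 : ℝ) ^ dyadicShell x) (2 ^ dyadicShell y) with h | h <;>
        rw [hM, h] <;> linarith

lemma dist_rpow_le_of_dyadicCell_eq {d : ℕ} {p : ℝ} (hp : 0 ≤ p) (l : ℕ)
    (x y : EuclideanSpace ℝ (Fin d)) (h : dyadicCell l x = dyadicCell l y) :
    dist x y ^ p ≤ (4 * d) ^ p * 2 ^ (-(p * (l + 1 : ℕ))) *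
      (shellWeight p x + shellWeight p y) := by
  have hs : dyadicShell x = dyadicShell y := congrArg Prod.fst h
  have h1 : dist x y ≤ d * (2 ^ dyadicShell x / 2 ^ l) := by
    rw [dist_eq_norm]
    refine euclidean_norm_le_of_forall_abs_le _ (by positivity) fun i => ?_
    have hi := congrFun (congrArg Prod.snd h) i
    simp only [dyadicCell, ← hs] at hi
    have := (Int.abs_sub_lt_one_of_floor_eq_floor hi).le
    rw [← mul_sub, ← sub_div, abs_mul, abs_div, abs_of_pos (by positivity : (0 : ℝ) < 2 ^ l),
      abs_of_pos (by positivity : (0 : ℝ) < 2 ^ dyadicShell x)] at this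
    simp only [PiLp.sub_apply]
    rw [le_div_iff₀ (by positivity)]
    rw [mul_div, div_le_one (by positivity)] at this
    linarith
  calc dist x y ^ p ≤ (d * (2 ^ dyadicShell x / 2 ^ l)) ^ p :=
        Real.rpow_le_rpow dist_nonneg h1 hp
    _ ≤ ((4 * d) * (2 ^ (l + 1))⁻¹ * 2 ^ dyadicShell x) ^ p := by
      refine Real.rpow_le_rpow (by positivity) ?_ hp
      rw [pow_succ, mul_inv]
      have : 0 ≤ (d : ℝ) * (2 ^ dyadicShell x / 2 ^ l) := by positivity
      calc (d : ℝ) * (2 ^ dyadicShell x / 2 ^ l) ≤ 2 * (d * (2 ^ dyadicShell x / 2 ^ l)) := by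
            linarith
        _ = _ := by ring
    _ = (4 * d) ^ p * 2 ^ (-(p * (l + 1 : ℕ))) * shellWeight p x := by
      rw [Real.mul_rpow (by positivity) (by positivity),
        Real.mul_rpow (by positivity) (by positivity), shellWeight, two_rpow_mul_natCast,
        Real.rpow_neg (by norm_num), two_rpow_mul_natCast, Real.inv_rpow (by positivity)]
    _ ≤ _ := by
      gcongr
      linarith [shellWeight_pos p y]

lemma dyadicCell_snd_mem_dyadicBox {d : ℕ} (l : ℕ) (x : EuclideanSpace ℝ (Fin d)) :
    (dyadicCell l x).2 ∈ dyadicBox d l := by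
  rw [dyadicBox, Fintype.mem_piFinset]
  intro i
  have h := abs_apply_le_two_pow_dyadicShell x i
  have h1 : |x i / 2 ^ dyadicShell x| ≤ 1 := by
    rw [abs_div, abs_of_pos (by positivity : (0 : ℝ) < 2 ^ dyadicShell x)]
    exact (div_le_one (by positivity)).2 h
  obtain ⟨h2, h3⟩ := abs_le.1 h1
  have h4 : (0 : ℝ) < 2 ^ l := by positivity
  simp only [dyadicCell, Finset.mem_Icc]
  constructor
  · rw [Int.le_floor]
    push_cast
    nlinarith
  · have : (2 : ℝ) ^ l * (x i / 2 ^ dyadicShell x) ≤ ((2 ^ l : ℤ) : ℝ) := by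
      push_cast
      nlinarith
    have h5 := Int.floor_le_floor this
    rwa [Int.floor_intCast] at h5

lemma card_dyadicBox_le (d l : ℕ) : ((dyadicBox d l).card : ℝ) ≤ 3 ^ d * (2 ^ l) ^ d := by
  rw [dyadicBox, Fintype.card_piFinset]
  simp only [Int.card_Icc, Finset.prod_const, Finset.card_univ, Fintype.card_fin]
  rw [← mul_pow]
  push_cast
  refine pow_le_pow_left₀ (by positivity) ?_ d
  have e : (2 ^ l + 1 - -2 ^ l : ℤ).toNat = 2 * 2 ^ l + 1 := by
    have : (2 ^ l + 1 - -2 ^ l : ℤ) = ((2 * 2 ^ l + 1 : ℕ) : ℤ) := by push_cast; ring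
    rw [this, Int.toNat_natCast]
  rw [e]
  push_cast
  have : (1 : ℝ) ≤ 2 ^ l := one_le_pow₀ (by norm_num)
  linarith

lemma sum_range_two_rpow_neg_le {p : ℝ} (hp : 1 ≤ p) (N : ℕ) :
    ∑ l ∈ Finset.range N, (2 : ℝ) ^ (-(p * l)) ≤ 2 := by
  calc ∑ l ∈ Finset.range N, (2 : ℝ) ^ (-(p * l)) ≤ ∑ l ∈ Finset.range N, (1 / 2 : ℝ) ^ l := by
        refine Finset.sum_le_sum fun l _ => ?_
        rw [one_div, inv_pow, ← Real.rpow_natCast, ← Real.rpow_neg (by norm_num)]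
        refine Real.rpow_le_rpow_of_exponent_le (by norm_num) ?_
        nlinarith [Nat.cast_nonneg (α := ℝ) l]
    _ ≤ 2 := sum_geometric_two_le N

/-- The cells of the levels below `N` in the dyadic shells with index in `S`. -/
noncomputable def dyadicIndex (d N : ℕ) (S : Finset ℕ) : Finset (Σ _ : ℕ, ℕ × (Fin d → ℤ)) :=
  (Finset.range N).sigma fun l => S ×ˢ dyadicBox d l

/-- The set of points in a cell. -/
def cellSet {d : ℕ} (j : Σ _ : ℕ, ℕ × (Fin d → ℤ)) : Set (EuclideanSpace ℝ (Fin d)) :=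
  dyadicCell j.1 ⁻¹' {j.2}

/-- The transport cost attached to a cell. -/
noncomputable def cellWeight {d : ℕ} (p : ℝ) (j : Σ _ : ℕ, ℕ × (Fin d → ℤ)) : ℝ :=
  2 ^ (-(p * j.1)) * 2 ^ (p * j.2.1)

lemma measurableSet_cellSet {d : ℕ} (j : Σ _ : ℕ, ℕ × (Fin d → ℤ)) :
    MeasurableSet (cellSet j) :=
  measurable_dyadicCell _ (measurableSet_singleton _)

lemma cellWeight_nonneg {d : ℕ} (p : ℝ) (j : Σ _ : ℕ, ℕ × (Fin d → ℤ)) : 0 ≤ cellWeight p j := by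
  unfold cellWeight; positivity

/-- The dyadic bound for the Wasserstein distance. -/
theorem wassersteinPow_le_dyadic {d : ℕ} {p : ℝ} (hp : 1 ≤ p)
    (ν μ : Measure (EuclideanSpace ℝ (Fin d))) [IsProbabilityMeasure ν] [IsProbabilityMeasure μ]
    (N : ℕ) (S : Finset ℕ) :
    wassersteinPow p ν μ ≤ ENNReal.ofReal ((4 * d) ^ p) *
      (ENNReal.ofReal (2 ^ (-(p * N))) * (∫⁻ x, ENNReal.ofReal (shellWeight p x) ∂ν +
          ∫⁻ x, ENNReal.ofReal (shellWeight p x) ∂μ) +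
        2 * (∫⁻ x in {x | dyadicShell x ∉ S}, ENNReal.ofReal (shellWeight p x) ∂ν +
          ∫⁻ x in {x | dyadicShell x ∉ S}, ENNReal.ofReal (shellWeight p x) ∂μ) +
        ∑ j ∈ dyadicIndex d N S, ENNReal.ofReal (cellWeight p j) *
          ENNReal.ofReal |ν.real (cellSet j) - μ.real (cellSet j)|) := by
  have hp0 : 0 ≤ p := by linarith
  set K : ℝ := (4 * d) ^ p with hK
  have hK0 : 0 ≤ K := by positivity
  have hofReal : ∀ x y : EuclideanSpace ℝ (Fin d),
      edist x y ^ p = ENNReal.ofReal (dist x y ^ p) := fun x y => by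
    rw [edist_dist, ENNReal.ofReal_rpow_of_nonneg dist_nonneg hp0]
  have hadd : ∀ (c : ℝ) (x y : EuclideanSpace ℝ (Fin d)), 0 ≤ c →
      ENNReal.ofReal c * (ENNReal.ofReal (shellWeight p x) + ENNReal.ofReal (shellWeight p y)) =
      ENNReal.ofReal (c * (shellWeight p x + shellWeight p y)) := fun c x y hc => by
    rw [ENNReal.ofReal_mul hc,
      ENNReal.ofReal_add (shellWeight_pos p x).le (shellWeight_pos p y).le]
  obtain ⟨η, h1, h2, h3⟩ := exists_multilevel_coupling
    (fun l => dyadicCell (d := d) l) measurable_dyadicCell dyadicCell_eq_of_succ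
    (fun z => edist z.1 z.2 ^ p) (fun x => ENNReal.ofReal (shellWeight p x))
    (measurable_shellWeight p).ennreal_ofReal
    (fun l => ENNReal.ofReal (K * 2 ^ (-(p * l))))
    (by
      intro x y
      simp only [Nat.cast_zero, mul_zero, neg_zero, Real.rpow_zero, mul_one]
      rw [hofReal, hadd _ _ _ hK0]
      exact ENNReal.ofReal_le_ofReal (dist_rpow_le_shellWeight hp0 x y))
    (by
      intro l x y hxy
      rw [hofReal, hadd _ _ _ (by positivity)]
      exact ENNReal.ofReal_le_ofReal (dist_rpow_le_of_dyadicCell_eq hp0 l x y hxy))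
    {x | dyadicShell x ∉ S} (measurable_dyadicShell (MeasurableSet.of_discrete (s := {m | m ∉ S})))
    (fun l => S ×ˢ dyadicBox d l)
    (fun c => ENNReal.ofReal (2 ^ (p * c.1)))
    (by
      intro l x hx
      simp only [Set.mem_ofPred_eq, not_not] at hx
      exact ⟨Finset.mem_product.2 ⟨hx, dyadicCell_snd_mem_dyadicBox l x⟩, le_rfl⟩)
    N ν μ (by simp)
  have hηp : IsProbabilityMeasure η := by
    constructor
    have : (η.map Prod.fst) Set.univ = 1 := by rw [h1]; simp
    rwa [Measure.map_apply measurable_fst MeasurableSet.univ, Set.preimage_univ] at this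
  refine (iInf₂_le η ⟨hηp, h1, h2⟩).trans (h3.trans ?_)
  have habs : ∀ s : Set (EuclideanSpace ℝ (Fin d)),
      (ν s - μ s) + (μ s - ν s) = ENNReal.ofReal |ν.real s - μ.real s| := by
    intro s
    rw [← ENNReal.ofReal_toReal (measure_ne_top ν s), ← ENNReal.ofReal_toReal (measure_ne_top μ s)]
    change ENNReal.ofReal (ν.real s) - ENNReal.ofReal (μ.real s) +
      (ENNReal.ofReal (μ.real s) - ENNReal.ofReal (ν.real s)) = _
    rw [← ENNReal.ofReal_sub _ measureReal_nonneg, ← ENNReal.ofReal_sub _ measureReal_nonneg]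
    rcases le_total (ν.real s) (μ.real s) with h | h
    · rw [ENNReal.ofReal_of_nonpos (by linarith), zero_add, abs_of_nonpos (by linarith), neg_sub]
    · rw [ENNReal.ofReal_of_nonpos (p := μ.real s - ν.real s) (by linarith), add_zero,
        abs_of_nonneg (by linarith)]
  simp only [habs]
  set DN := ∫⁻ x, ENNReal.ofReal (shellWeight p x) ∂ν + ∫⁻ x, ENNReal.ofReal (shellWeight p x) ∂μ
  set DO := ∫⁻ x in {x | dyadicShell x ∉ S}, ENNReal.ofReal (shellWeight p x) ∂ν +
    ∫⁻ x in {x | dyadicShell x ∉ S}, ENNReal.ofReal (shellWeight p x) ∂μ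
  have hsum : ∑ l ∈ Finset.range N, ENNReal.ofReal (2 ^ (-(p * l))) ≤ 2 := by
    rw [← ENNReal.ofReal_sum_of_nonneg (fun l _ => by positivity)]
    calc _ ≤ ENNReal.ofReal 2 := ENNReal.ofReal_le_ofReal (sum_range_two_rpow_neg_le hp N)
      _ = 2 := by simp
  simp only [ENNReal.ofReal_mul hK0, mul_assoc]
  rw [← Finset.mul_sum, ← mul_add]
  refine mul_le_mul_right ?_ _
  simp only [mul_add, Finset.sum_add_distrib, ← Finset.sum_mul]
  rw [← add_assoc]
  refine add_le_add (add_le_add le_rfl ?_) ?_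
  · exact mul_le_mul_left hsum _
  · rw [dyadicIndex, Finset.sum_sigma]
    simp only [Finset.mul_sum]
    refine Finset.sum_le_sum fun l _ => Finset.sum_le_sum fun c _ => ?_
    rw [cellWeight, ENNReal.ofReal_mul (by positivity), mul_assoc]
    rfl

lemma isProbabilityMeasure_empiricalMeasure {d : ℕ} {Ω : Type*}
    (X : ℕ → Ω → EuclideanSpace ℝ (Fin d)) {k : ℕ} (hk : 1 ≤ k) (ω : Ω) :
    IsProbabilityMeasure (empiricalMeasure X k ω) := by
  constructor
  simp only [empiricalMeasure, Measure.smul_apply, Measure.coe_finsetSum, Finset.sum_apply,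
    measure_univ, Finset.sum_const, Finset.card_range, nsmul_eq_mul, mul_one, smul_eq_mul]
  exact ENNReal.inv_mul_cancel (by simp; omega) (ENNReal.natCast_ne_top k)

/-- The weighted sum of the deviations of the empirical frequencies of the cells. -/
noncomputable def deviationNorm {E Ω ι : Type*} [MeasurableSpace E] (μ : Measure E)
    (X : ℕ → Ω → E) (J : Finset ι) (w : ι → ℝ) (A : ι → Set E) (k : ℕ) (ω : Ω) : ℝ :=
  ∑ j ∈ J, w j * |∑ i ∈ Finset.range k, ((A j).indicator 1 (X i ω) - μ.real (A j))|

theorem mul_wassersteinPow_empiricalMeasure_le {d : ℕ} {Ω : Type*} {p : ℝ} (hp : 1 ≤ p)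
    (μ : Measure (EuclideanSpace ℝ (Fin d))) [IsProbabilityMeasure μ]
    (hint : Integrable (shellWeight p) μ) (X : ℕ → Ω → EuclideanSpace ℝ (Fin d))
    (N : ℕ) (S : Finset ℕ) {T : ℝ} (hT : 0 ≤ T) {n k : ℕ} (hk : 1 ≤ k) (hkn : k ≤ n) (ω : Ω)
    (hX : ∀ i < n, dyadicShell (X i ω) ∈ S ∧ shellWeight p (X i ω) ≤ T) :
    (k : ℝ≥0∞) * wassersteinPow p (empiricalMeasure X k ω) μ ≤ ENNReal.ofReal ((4 * d) ^ p *
      (2 ^ (-(p * N)) * (n * (T + ∫ x, shellWeight p x ∂μ)) +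
        2 * (n * ∫ x in {x | dyadicShell x ∉ S}, shellWeight p x ∂μ) +
        deviationNorm μ X (dyadicIndex d N S) (cellWeight p) cellSet k ω)) := by
  have := isProbabilityMeasure_empiricalMeasure X hk ω
  have hk0 : (k : ℝ≥0∞) ≠ 0 := by simp; omega
  have hkt : (k : ℝ≥0∞) ≠ ∞ := ENNReal.natCast_ne_top k
  have hD0 : ∀ ρ : Measure (EuclideanSpace ℝ (Fin d)), 0 ≤ ∫ x, shellWeight p x ∂ρ :=
    fun ρ => integral_nonneg fun x => (shellWeight_pos p x).le
  have hmD := (measurable_shellWeight (d := d) p).ennreal_ofReal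
  have hOm : MeasurableSet {x : EuclideanSpace ℝ (Fin d) | dyadicShell x ∉ S} :=
    measurable_dyadicShell (MeasurableSet.of_discrete (s := {m | m ∉ S}))
  have hlint : ∀ f : EuclideanSpace ℝ (Fin d) → ℝ≥0∞, Measurable f →
      (k : ℝ≥0∞) * ∫⁻ x, f x ∂(empiricalMeasure X k ω) = ∑ i ∈ Finset.range k, f (X i ω) := by
    intro f hf
    rw [empiricalMeasure, lintegral_smul_measure, lintegral_finsetSum_measure, smul_eq_mul,
      ← mul_assoc, ENNReal.mul_inv_cancel hk0 hkt, one_mul]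
    exact Finset.sum_congr rfl fun i _ => lintegral_dirac' _ hf
  have e1 : (k : ℝ≥0∞) * ∫⁻ x, ENNReal.ofReal (shellWeight p x) ∂(empiricalMeasure X k ω)
      ≤ ENNReal.ofReal (n * T) := by
    rw [hlint _ hmD, ENNReal.ofReal_mul (by positivity), ENNReal.ofReal_natCast]
    calc _ ≤ ∑ i ∈ Finset.range k, ENNReal.ofReal T := Finset.sum_le_sum fun i hi =>
          ENNReal.ofReal_le_ofReal (hX i (by have := Finset.mem_range.1 hi; omega)).2
      _ = k * ENNReal.ofReal T := by simp
      _ ≤ _ := by gcongr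
  have e2 : (k : ℝ≥0∞) * ∫⁻ x, ENNReal.ofReal (shellWeight p x) ∂μ
      ≤ ENNReal.ofReal (n * ∫ x, shellWeight p x ∂μ) := by
    rw [← ofReal_integral_eq_lintegral_ofReal hint (ae_of_all _ fun x => (shellWeight_pos p x).le),
      ENNReal.ofReal_mul (by positivity), ENNReal.ofReal_natCast]
    gcongr
  have e3 : (k : ℝ≥0∞) * ∫⁻ x in {x | dyadicShell x ∉ S}, ENNReal.ofReal (shellWeight p x)
      ∂(empiricalMeasure X k ω) = 0 := by
    rw [← lintegral_indicator hOm, hlint _ (hmD.indicator hOm)]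
    refine Finset.sum_eq_zero fun i hi => Set.indicator_of_notMem ?_ _
    simpa using (hX i (by have := Finset.mem_range.1 hi; omega)).1
  have e4 : (k : ℝ≥0∞) * ∫⁻ x in {x | dyadicShell x ∉ S}, ENNReal.ofReal (shellWeight p x) ∂μ
      ≤ ENNReal.ofReal (n * ∫ x in {x | dyadicShell x ∉ S}, shellWeight p x ∂μ) := by
    rw [← ofReal_integral_eq_lintegral_ofReal hint.restrict
        (ae_of_all _ fun x => (shellWeight_pos p x).le),
      ENNReal.ofReal_mul (by positivity), ENNReal.ofReal_natCast]
    gcongr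
  have e5 : ∀ j ∈ dyadicIndex d N S, (k : ℝ≥0∞) * (ENNReal.ofReal (cellWeight p j) *
      ENNReal.ofReal |(empiricalMeasure X k ω).real (cellSet j) - μ.real (cellSet j)|) =
      ENNReal.ofReal (cellWeight p j *
        |∑ i ∈ Finset.range k, ((cellSet j).indicator 1 (X i ω) - μ.real (cellSet j))|) := by
    intro j _
    rw [← ENNReal.ofReal_natCast, ← ENNReal.ofReal_mul (cellWeight_nonneg p j),
      ← ENNReal.ofReal_mul (by positivity)]
    congr 1
    rw [mul_left_comm]
    congr 1
    have hk' : (0 : ℝ) < k := by exact_mod_cast hk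
    rw [show (k : ℝ) * |(empiricalMeasure X k ω).real (cellSet j) - μ.real (cellSet j)| =
      |k * ((empiricalMeasure X k ω).real (cellSet j) - μ.real (cellSet j))| by
        rw [abs_mul, abs_of_pos hk']]
    congr 1
    have : (empiricalMeasure X k ω).real (cellSet j)
        = (k : ℝ)⁻¹ * ∑ i ∈ Finset.range k, (cellSet j).indicator 1 (X i ω) := by
      rw [Measure.real, empiricalMeasure]
      simp only [Measure.smul_apply, Measure.coe_finsetSum, Finset.sum_apply, smul_eq_mul,
        ENNReal.toReal_mul, ENNReal.toReal_inv, ENNReal.toReal_natCast]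
      congr 1
      rw [ENNReal.toReal_sum (fun i _ => measure_ne_top _ _)]
      refine Finset.sum_congr rfl fun i _ => ?_
      rw [Measure.dirac_apply' _ (measurableSet_cellSet j)]
      by_cases h : X i ω ∈ cellSet j <;> simp [h]
    rw [this, mul_sub, ← mul_assoc, mul_inv_cancel₀ hk'.ne', one_mul, Finset.sum_sub_distrib]
    simp
  have hO0 : 0 ≤ ∫ x in {x | dyadicShell x ∉ S}, shellWeight p x ∂μ := hD0 _
  have hdev0 : 0 ≤ deviationNorm μ X (dyadicIndex d N S) (cellWeight p) cellSet k ω :=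
    Finset.sum_nonneg fun j _ => mul_nonneg (cellWeight_nonneg p j) (abs_nonneg _)
  have hDμ := hD0 μ
  calc _ ≤ (k : ℝ≥0∞) * _ := mul_le_mul_right (wassersteinPow_le_dyadic hp _ μ N S) _
    _ = ENNReal.ofReal ((4 * d) ^ p) *
      (ENNReal.ofReal (2 ^ (-(p * N))) *
          (k * ∫⁻ x, ENNReal.ofReal (shellWeight p x) ∂(empiricalMeasure X k ω) +
          k * ∫⁻ x, ENNReal.ofReal (shellWeight p x) ∂μ) +
        2 * (k * ∫⁻ x in {x | dyadicShell x ∉ S}, ENNReal.ofReal (shellWeight p x)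
            ∂(empiricalMeasure X k ω) +
          k * ∫⁻ x in {x | dyadicShell x ∉ S}, ENNReal.ofReal (shellWeight p x) ∂μ) +
        ∑ j ∈ dyadicIndex d N S, k * (ENNReal.ofReal (cellWeight p j) *
          ENNReal.ofReal
            |(empiricalMeasure X k ω).real (cellSet j) - μ.real (cellSet j)|)) := by
      rw [← Finset.mul_sum]
      ring
    _ ≤ _ := by
      rw [Finset.sum_congr rfl e5, ← ENNReal.ofReal_sum_of_nonneg
        (fun j _ => mul_nonneg (cellWeight_nonneg p j) (abs_nonneg _)), e3, zero_add,
        ENNReal.ofReal_mul (by positivity), ENNReal.ofReal_add (by positivity) hdev0,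
        ENNReal.ofReal_add (by positivity) (by positivity), ENNReal.ofReal_mul (by positivity),
        ENNReal.ofReal_mul (by positivity : (0 : ℝ) ≤ 2), mul_add (n : ℝ),
        ENNReal.ofReal_add (by positivity) (by positivity)]
      gcongr
      · simp
      · rfl

lemma memLp_two_of_abs_le {Ω : Type*} [MeasurableSpace Ω] {P : Measure Ω} [IsFiniteMeasure P]
    {f : Ω → ℝ} (hf : Measurable f) {K : ℝ} (h : ∀ ω, |f ω| ≤ K) : MemLp f 2 P :=
  MemLp.of_bound hf.aestronglyMeasurable K (ae_of_all _ h)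

lemma integrable_of_abs_le {Ω : Type*} [MeasurableSpace Ω] {P : Measure Ω} [IsFiniteMeasure P]
    {f : Ω → ℝ} (hf : Measurable f) {K : ℝ} (h : ∀ ω, |f ω| ≤ K) : Integrable f P :=
  Integrable.of_bound hf.aestronglyMeasurable K (ae_of_all _ h)

/-- Decomposition of the variance of a function of two independent random variables. -/
lemma variance_comp_prodMk_le {Ω A B : Type*} [MeasurableSpace Ω] [MeasurableSpace A]
    [MeasurableSpace B] {P : Measure Ω} [IsProbabilityMeasure P] {Z : Ω → A} {Y : Ω → B}
    (hZ : Measurable Z) (hY : Measurable Y) (hZY : IndepFun Z Y P) {φ : A × B → ℝ}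
    (hφ : Measurable φ) {K : ℝ} (hφK : ∀ z, |φ z| ≤ K) {φ₀ : A → ℝ} (hφ₀ : Measurable φ₀)
    (hφ₀K : ∀ a, |φ₀ a| ≤ K) {c : B → ℝ} (hc : ∀ a y, |φ (a, y) - φ₀ a| ≤ c y)
    (hcint : Integrable (fun y => c y ^ 2) (P.map Y)) {b : ℝ}
    (hb : ∀ y, Var[fun ω => φ (Z ω, y); P] ≤ b) :
    Var[fun ω => φ (Z ω, Y ω); P] ≤ b + ∫ y, c y ^ 2 ∂(P.map Y) := by
  have hρ : IsProbabilityMeasure (P.map Z) := Measure.isProbabilityMeasure_map hZ.aemeasurable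
  have hτ : IsProbabilityMeasure (P.map Y) := Measure.isProbabilityMeasure_map hY.aemeasurable
  set ρ := P.map Z with hρdef
  set τ := P.map Y with hτdef
  have hmap : P.map (fun ω => (Z ω, Y ω)) = ρ.prod τ :=
    (indepFun_iff_map_prod_eq_prod_map_map hZ.aemeasurable hY.aemeasurable).1 hZY
  set ψ := ∫ a, φ₀ a ∂ρ with hψ
  have hψK : |ψ| ≤ K := by
    have := norm_integral_le_of_norm_le_const (μ := ρ) (f := φ₀)
      (ae_of_all _ fun a => by rw [Real.norm_eq_abs]; exact hφ₀K a)
    simpa using this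
  have hm : Measurable fun z => (φ z - ψ) ^ 2 := (hφ.sub measurable_const).pow_const 2
  have hdiff : ∀ z, |φ z - ψ| ≤ 2 * K := fun z => by
    have := abs_sub (φ z) ψ
    linarith [hφK z]
  have hsq : ∀ z, |(φ z - ψ) ^ 2| ≤ (2 * K) ^ 2 := fun z => by
    rw [abs_pow]
    exact pow_le_pow_left₀ (abs_nonneg _) (hdiff z) 2
  have hinner : ∀ y, ∫ a, (φ (a, y) - ψ) ^ 2 ∂ρ ≤ b + c y ^ 2 := by
    intro y
    have hmy : Measurable fun a => φ (a, y) := hφ.comp (measurable_id.prodMk measurable_const)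
    have hL : MemLp (fun a => φ (a, y) - ψ) 2 ρ :=
      memLp_two_of_abs_le (hmy.sub measurable_const) (fun a => hdiff (a, y))
    have h1 := variance_eq_sub hL
    rw [variance_sub_const hmy.aestronglyMeasurable, hρdef,
      variance_map hmy.aemeasurable hZ.aemeasurable, ← hρdef] at h1
    have h2 : Var[(fun a => φ (a, y)) ∘ Z; P] ≤ b := hb y
    have h3 : |∫ a, (φ (a, y) - ψ) ∂ρ| ≤ c y := by
      have i1 : Integrable (fun a => φ (a, y)) ρ := integrable_of_abs_le hmy (fun a => hφK _)
      have i2 : Integrable φ₀ ρ := integrable_of_abs_le hφ₀ hφ₀K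
      have e : ∫ a, (φ (a, y) - ψ) ∂ρ = ∫ a, (φ (a, y) - φ₀ a) ∂ρ := by
        rw [integral_sub i1 (integrable_const _), integral_sub i1 i2]
        simp [hψ]
      rw [e]
      have := norm_integral_le_of_norm_le_const (μ := ρ) (f := fun a => φ (a, y) - φ₀ a)
        (ae_of_all _ fun a => hc a y)
      simpa using this
    have h4 : (∫ a, (φ (a, y) - ψ) ∂ρ) ^ 2 ≤ c y ^ 2 := by
      rw [← sq_abs]
      exact pow_le_pow_left₀ (abs_nonneg _) h3 2
    simp only [Pi.pow_apply] at h1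
    linarith
  calc Var[fun ω => φ (Z ω, Y ω); P] = Var[fun ω => φ (Z ω, Y ω) - ψ; P] :=
        (variance_sub_const (hφ.comp (hZ.prodMk hY)).aestronglyMeasurable ψ).symm
    _ ≤ ∫ ω, (φ (Z ω, Y ω) - ψ) ^ 2 ∂P :=
      variance_le_expectation_sq (X := fun ω => φ (Z ω, Y ω) - ψ)
        ((hφ.comp (hZ.prodMk hY)).sub measurable_const).aestronglyMeasurable
    _ = ∫ z, (φ z - ψ) ^ 2 ∂(ρ.prod τ) := by
      rw [← hmap, integral_map (hZ.prodMk hY).aemeasurable hm.aestronglyMeasurable]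
    _ = ∫ y, ∫ a, (φ (a, y) - ψ) ^ 2 ∂ρ ∂τ := integral_prod_symm _ (integrable_of_abs_le hm hsq)
    _ ≤ ∫ y, (b + c y ^ 2) ∂τ := by
      refine integral_mono_of_nonneg (ae_of_all _ fun y => integral_nonneg fun a => sq_nonneg _)
        ((integrable_const _).add hcint) (ae_of_all _ hinner)
    _ = b + ∫ y, c y ^ 2 ∂τ := by
      rw [integral_add (integrable_const _) hcint]
      simp

lemma abs_sum_mul_abs_le {ι : Type*} (J : Finset ι) {w u : ι → ℝ} (hw : ∀ j ∈ J, 0 ≤ w j)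
    {b : ι → ℝ} (hu : ∀ j, |u j| ≤ b j) : |(∑ j ∈ J, w j * |u j|)| ≤ ∑ j ∈ J, w j * b j := by
  rw [abs_of_nonneg (Finset.sum_nonneg fun j hj => mul_nonneg (hw j hj) (abs_nonneg _))]
  exact Finset.sum_le_sum fun j hj => mul_le_mul_of_nonneg_left (hu j) (hw j hj)

/-- The Efron-Stein type bound for the variance of the weighted `ℓ¹` norm of a sum of independent
and identically distributed vectors. -/
theorem variance_weighted_sum_abs_le {Ω E ι : Type*} [MeasurableSpace Ω] [MeasurableSpace E]
    {P : Measure Ω} [IsProbabilityMeasure P] {μ : Measure E} {X : ℕ → Ω → E}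
    (hmeas : ∀ i, Measurable (X i)) (hindep : iIndepFun X P) (hlaw : ∀ i, P.map (X i) = μ)
    (J : Finset ι) {w : ι → ℝ} (hw : ∀ j ∈ J, 0 ≤ w j) {f : ι → E → ℝ}
    (hf : ∀ j, Measurable (f j)) {B : ℝ} (hfB : ∀ j x, |f j x| ≤ B) {c : E → ℝ}
    (hc : ∀ x, ∑ j ∈ J, w j * |f j x| ≤ c x) (hcint : Integrable (fun x => c x ^ 2) μ)
    (k : ℕ) (v : ι → ℝ) :
    Var[fun ω => ∑ j ∈ J, w j * |v j + ∑ i ∈ Finset.range k, f j (X i ω)|; P] ≤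
      k * ∫ x, c x ^ 2 ∂μ := by
  induction k generalizing v with
  | zero => simp [variance_eq_integral measurable_const.aemeasurable]
  | succ k ih =>
    let φ₀ : (Finset.range k → E) → ℝ :=
      fun a => ∑ j ∈ J, w j * |v j + ∑ i : Finset.range k, f j (a i)|
    let φ : (Finset.range k → E) × E → ℝ :=
      fun z => ∑ j ∈ J, w j * |v j + f j z.2 + ∑ i : Finset.range k, f j (z.1 i)|
    have hφ₀m : Measurable φ₀ := by
      refine Finset.measurable_fun_sum _ fun j _ => measurable_const.mul ?_
      refine Measurable.abs (measurable_const.add ?_)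
      exact Finset.measurable_fun_sum _ fun i _ => (hf j).comp (measurable_pi_apply i)
    have hφm : Measurable φ := by
      refine Finset.measurable_fun_sum _ fun j _ => measurable_const.mul ?_
      refine Measurable.abs (Measurable.add (measurable_const.add ((hf j).comp measurable_snd)) ?_)
      exact Finset.measurable_fun_sum _ fun i _ =>
        (hf j).comp ((measurable_pi_apply i).comp measurable_fst)
    have hsumB : ∀ j (a : Finset.range k → E), |∑ i : Finset.range k, f j (a i)| ≤ k * B := by
      intro j a
      calc _ ≤ ∑ i : Finset.range k, |f j (a i)| := Finset.abs_sum_le_sum_abs _ _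
        _ ≤ ∑ _i : Finset.range k, B := Finset.sum_le_sum fun i _ => hfB j _
        _ = k * B := by simp
    have hZ : Measurable (fun ω (i : Finset.range k) => X i ω) :=
      measurable_pi_lambda _ fun i => hmeas i
    have hind : IndepFun (fun ω (i : Finset.range k) => X i ω) (X k) P := by
      have h := hindep.indepFun_finset (Finset.range k) {k} (by simp) hmeas
      exact h.comp measurable_id (measurable_pi_apply (⟨k, by simp⟩ : ({k} : Finset ℕ)))
    have hB0 : ∀ j (x : E), 0 ≤ B := fun j x => (abs_nonneg _).trans (hfB j x)
    have hmain := variance_comp_prodMk_le (P := P) hZ (hmeas k) hind (φ := φ) hφm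
      (K := ∑ j ∈ J, w j * (|v j| + |B| + k * B)) ?_ (φ₀ := φ₀) hφ₀m ?_ (c := c) ?_
      (by rw [hlaw]; exact hcint) (b := k * ∫ x, c x ^ 2 ∂μ) ?_
    · rw [hlaw] at hmain
      have e : (fun ω => ∑ j ∈ J, w j * |v j + ∑ i ∈ Finset.range (k + 1), f j (X i ω)|)
          = fun ω => φ ((fun (i : Finset.range k) => X i ω), X k ω) := by
        funext ω
        refine Finset.sum_congr rfl fun j _ => ?_
        rw [Finset.sum_range_succ, Finset.sum_coe_sort (Finset.range k) (fun i => f j (X i ω))]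
        congr 2
        ring
      rw [e]
      refine hmain.trans (le_of_eq ?_)
      push_cast
      ring
    · intro z
      refine abs_sum_mul_abs_le J hw fun j => ?_
      refine (abs_add_le _ _).trans (add_le_add ((abs_add_le _ _).trans ?_) (hsumB j z.1))
      exact add_le_add le_rfl ((hfB j z.2).trans (le_abs_self B))
    · intro a
      refine abs_sum_mul_abs_le J hw fun j => ?_
      refine (abs_add_le _ _).trans (add_le_add ?_ (hsumB j a))
      linarith [abs_nonneg B]
    · intro a y
      refine le_trans ?_ (hc y)
      rw [← Finset.sum_sub_distrib]
      refine (Finset.abs_sum_le_sum_abs _ _).trans (Finset.sum_le_sum fun j hj => ?_)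
      rw [← mul_sub, abs_mul, abs_of_nonneg (hw j hj)]
      refine mul_le_mul_of_nonneg_left ((abs_abs_sub_abs_le_abs_sub _ _).trans (le_of_eq ?_))
        (hw j hj)
      congr 1
      ring
    · intro y
      refine le_trans (le_of_eq ?_) (ih (fun j => v j + f j y))
      congr 1
      funext ω
      refine Finset.sum_congr rfl fun j _ => ?_
      rw [Finset.sum_coe_sort (Finset.range k) (fun i => f j (X i ω))]

/-- A maximal inequality of Chebyshev type for nonnegative submartingales. -/
lemma measure_exists_le_submartingale_le {Ω : Type*} {m0 : MeasurableSpace Ω} {P : Measure Ω}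
    [IsProbabilityMeasure P] {𝒢 : Filtration ℕ m0} {g : ℕ → Ω → ℝ} (hg : Submartingale g 𝒢 P)
    (hg0 : 0 ≤ g) (n : ℕ) (hn : MemLp (g n) 2 P) {ε : ℝ} (hε : P[g n] < ε) :
    P {ω | ∃ k ≤ n, ε ≤ g k ω} ≤ ENNReal.ofReal (Var[g n; P] / (ε - P[g n]) ^ 2) := by
  have hm0 : 0 ≤ P[g n] := integral_nonneg (hg0 n)
  have hε0 : 0 ≤ ε := hm0.trans hε.le
  have hmax := maximal_ineq hg hg0 (ε := ⟨ε, hε0⟩) n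
  set A := {ω | ((⟨ε, hε0⟩ : NNReal) : ℝ) ≤
    (Finset.range (n + 1)).sup' Finset.nonempty_range_add_one fun k => g k ω} with hA
  have hAm : MeasurableSet A := by
    refine measurableSet_le measurable_const ?_
    refine Finset.measurable_range_sup'' fun k _ => ?_
    exact ((hg.1 k).mono (𝒢.le k)).measurable
  have hAeq : {ω | ∃ k ≤ n, ε ≤ g k ω} = A := by
    ext ω
    simp only [hA, Set.mem_ofPred_eq, Finset.le_sup'_iff, Finset.mem_range,
      Nat.lt_succ_iff]
  rw [hAeq]
  set m := P[g n] with hm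
  set s := ε - m with hs
  have hs0 : 0 < s := by rw [hs]; linarith
  have hint : Integrable (g n) P := hg.integrable n
  have h1 : ε * P.real A ≤ ∫ ω in A, g n ω ∂P := by
    have hnn : 0 ≤ ∫ ω in A, g n ω ∂P := setIntegral_nonneg hAm fun ω _ => hg0 n ω
    have h := ENNReal.toReal_mono ENNReal.ofReal_ne_top hmax
    rw [ENNReal.toReal_mul] at h
    exact h.trans (le_of_eq (ENNReal.toReal_ofReal hnn))
  have h2 : Var[g n; P] = ∫ ω, (g n ω - m) ^ 2 ∂P := variance_eq_integral hint.aemeasurable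
  have hsqint : Integrable (fun ω => (g n ω - m) ^ 2) P :=
    (hn.sub (memLp_const m)).integrable_sq
  have h3 : ∫ ω in A, g n ω ∂P ≤ ∫ ω in A, (m + s / 2 + (g n ω - m) ^ 2 / (2 * s)) ∂P := by
    refine setIntegral_mono hint.integrableOn
      (((integrable_const _).add (hsqint.div_const _)).integrableOn) fun ω => ?_
    have : 0 ≤ (g n ω - m - s) ^ 2 / (2 * s) := by positivity
    have e : (g n ω - m - s) ^ 2 / (2 * s)
        = (g n ω - m) ^ 2 / (2 * s) - (g n ω - m) + s / 2 := by
      field_simp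
      ring
    simp only
    linarith
  have h4 : ∫ ω in A, (m + s / 2 + (g n ω - m) ^ 2 / (2 * s)) ∂P
      ≤ (m + s / 2) * P.real A + Var[g n; P] / (2 * s) := by
    rw [integral_add (integrable_const _).integrableOn (hsqint.div_const _).integrableOn,
      setIntegral_const, smul_eq_mul, mul_comm, integral_div, h2]
    gcongr
    · exact ae_of_all _ fun ω => sq_nonneg _
    · exact Measure.restrict_le_self
  have h5 : P.real A ≤ Var[g n; P] / s ^ 2 := by
    rw [le_div_iff₀ (by positivity)]
    have h6 : (s / 2) * P.real A ≤ Var[g n; P] / (2 * s) := by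
      have : ε = m + s := by rw [hs]; ring
      rw [this] at h1
      nlinarith
    rw [le_div_iff₀ (by positivity)] at h6
    nlinarith
  rw [← ENNReal.ofReal_toReal (measure_ne_top P A)]
  exact ENNReal.ofReal_le_ofReal h5

lemma submartingale_finset_sum {Ω ι : Type*} {m0 : MeasurableSpace Ω} {P : Measure Ω}
    {𝒢 : Filtration ℕ m0} (J : Finset ι) {g : ι → ℕ → Ω → ℝ}
    (hg : ∀ j ∈ J, Submartingale (g j) 𝒢 P) : Submartingale (∑ j ∈ J, g j) 𝒢 P := by
  classical
  induction J using Finset.induction_on with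
  | empty =>
    simp only [Finset.sum_empty]
    exact (martingale_zero ℝ 𝒢 P).submartingale
  | insert a s ha ih =>
    rw [Finset.sum_insert ha]
    exact (hg a (by simp)).add (ih fun j hj => hg j (by simp [hj]))

/-- Partial sums of centered functions of independent random variables form a martingale. -/
lemma martingale_sum_range_succ {Ω E : Type*} [MeasurableSpace Ω] [MeasurableSpace E]
    [NormedAddCommGroup E] [BorelSpace E]
    {P : Measure Ω} [IsProbabilityMeasure P] {μ : Measure E} {X : ℕ → Ω → E}
    (hmeas : ∀ i, StronglyMeasurable (X i)) (hindep : iIndepFun X P)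
    (hlaw : ∀ i, P.map (X i) = μ) {f : E → ℝ} (hf : Measurable f) {B : ℝ} (hfB : ∀ x, |f x| ≤ B)
    (hf0 : ∫ x, f x ∂μ = 0) :
    Martingale (fun k ω => ∑ i ∈ Finset.range (k + 1), f (X i ω))
      (Filtration.natural X hmeas) P := by
  have hadX := Filtration.stronglyAdapted_natural hmeas
  have hint : ∀ i, Integrable (fun ω => f (X i ω)) P := fun i =>
    integrable_of_abs_le (hf.comp (hmeas i).measurable) fun ω => hfB _
  have hadp : StronglyAdapted (Filtration.natural X hmeas)
      (fun k ω => ∑ i ∈ Finset.range (k + 1), f (X i ω)) := by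
    intro k
    refine Finset.stronglyMeasurable_fun_sum _ fun i hi => ?_
    have h1 := (hadX i).mono ((Filtration.natural X hmeas).mono
      (Nat.lt_succ_iff.1 (Finset.mem_range.1 hi)))
    exact (hf.comp h1.measurable).stronglyMeasurable
  refine martingale_of_condExp_sub_eq_zero_nat hadp
    (fun k => integrable_finsetSum _ fun i _ => hint i) fun k => ?_
  have e : ((fun ω => ∑ i ∈ Finset.range (k + 1 + 1), f (X i ω)) -
      fun ω => ∑ i ∈ Finset.range (k + 1), f (X i ω)) = fun ω => f (X (k + 1) ω) := by
    funext ω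
    simp only [Pi.sub_apply]
    rw [Finset.sum_range_succ _ (k + 1)]
    ring
  rw [e]
  have h := condExp_indep_eq (m₁ := MeasurableSpace.comap (X (k + 1)) inferInstance)
    (m₂ := Filtration.natural X hmeas k) (f := fun ω => f (X (k + 1) ω)) (μ := P)
    (hmeas (k + 1)).measurable.comap_le ((Filtration.natural X hmeas).le k)
    ((hf.comp (comap_measurable (X (k + 1)))).stronglyMeasurable)
    (hindep.indep_comap_natural_of_lt hmeas (Nat.lt_succ_self k))
  refine h.trans (ae_of_all _ fun ω => ?_)
  have : ∫ ω, f (X (k + 1) ω) ∂P = 0 := by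
    rw [← hf0, ← hlaw (k + 1), integral_map (hmeas _).measurable.aemeasurable
      hf.aestronglyMeasurable]
  simpa using this

/-- Maximal deviation inequality for the weighted deviations of the empirical frequencies. -/
theorem measure_exists_le_deviationNorm_le {Ω E ι : Type*} [MeasurableSpace Ω] [MeasurableSpace E]
    [NormedAddCommGroup E] [BorelSpace E]
    {P : Measure Ω} [IsProbabilityMeasure P] {μ : Measure E} [IsProbabilityMeasure μ]
    {X : ℕ → Ω → E} (hmeas : ∀ i, StronglyMeasurable (X i)) (hindep : iIndepFun X P)
    (hlaw : ∀ i, P.map (X i) = μ) (J : Finset ι) {w : ι → ℝ} (hw : ∀ j ∈ J, 0 ≤ w j)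
    {A : ι → Set E} (hA : ∀ j, MeasurableSet (A j)) {c : E → ℝ}
    (hc : ∀ x, ∑ j ∈ J, w j * |(A j).indicator 1 x - μ.real (A j)| ≤ c x)
    (hcint : Integrable (fun x => c x ^ 2) μ) {n : ℕ} (hn : 1 ≤ n) {ε M : ℝ}
    (hM : ∫ ω, deviationNorm μ X J w A n ω ∂P ≤ M) (hε : M < ε) :
    P {ω | ∃ k, 1 ≤ k ∧ k ≤ n ∧ ε ≤ deviationNorm μ X J w A k ω} ≤
      ENNReal.ofReal (n * (∫ x, c x ^ 2 ∂μ) / (ε - M) ^ 2) := by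
  obtain ⟨N, rfl⟩ : ∃ N, n = N + 1 := ⟨n - 1, by omega⟩
  let f : ι → E → ℝ := fun j x => (A j).indicator 1 x - μ.real (A j)
  have hind : ∀ j, Measurable ((A j).indicator (1 : E → ℝ)) := fun j =>
    measurable_const.indicator (hA j)
  have hf : ∀ j, Measurable (f j) := fun j => (hind j).sub measurable_const
  have hfB : ∀ j x, |f j x| ≤ 1 := by
    intro j x
    have h0 : 0 ≤ μ.real (A j) := measureReal_nonneg
    have h1 : μ.real (A j) ≤ 1 := measureReal_le_one
    rw [abs_le]
    by_cases hx : x ∈ A j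
    · simp only [f, Set.indicator_of_mem hx, Pi.one_apply]
      constructor <;> linarith
    · simp only [f, Set.indicator_of_notMem hx]
      constructor <;> linarith
  have hf0 : ∀ j, ∫ x, f j x ∂μ = 0 := by
    intro j
    have hi : Integrable ((A j).indicator (1 : E → ℝ)) μ :=
      (integrable_const (1 : ℝ)).indicator (hA j)
    rw [integral_sub hi (integrable_const _), integral_indicator_one (hA j)]
    simp
  let g : ℕ → Ω → ℝ := fun k ω => deviationNorm μ X J w A (k + 1) ω
  have hsub : Submartingale g (Filtration.natural X hmeas) P := by
    have e : g = ∑ j ∈ J, w j • ((fun k ω => ∑ i ∈ Finset.range (k + 1), f j (X i ω)) ⊔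
        -(fun k ω => ∑ i ∈ Finset.range (k + 1), f j (X i ω))) := by
      funext k ω
      simp only [g, deviationNorm, Finset.sum_apply, Pi.smul_apply, Pi.sup_apply, Pi.neg_apply,
        smul_eq_mul]
      rfl
    rw [e]
    refine submartingale_finset_sum J fun j hj => ?_
    have hmart := martingale_sum_range_succ hmeas hindep hlaw (hf j) (hfB j) (hf0 j)
    exact (hmart.submartingale.sup hmart.neg.submartingale).smul_nonneg (hw j hj)
  have hg0 : 0 ≤ g := fun k ω => Finset.sum_nonneg fun j hj => mul_nonneg (hw j hj) (abs_nonneg _)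
  have hgm : Measurable (g N) := (((hsub.1 N).mono ((Filtration.natural X hmeas).le N))).measurable
  have hgL : MemLp (g N) 2 P := by
    refine memLp_two_of_abs_le hgm (K := ∑ j ∈ J, w j * (N + 1)) fun ω => ?_
    refine abs_sum_mul_abs_le J hw fun j => ?_
    calc _ ≤ ∑ i ∈ Finset.range (N + 1), |f j (X i ω)| := Finset.abs_sum_le_sum_abs _ _
      _ ≤ ∑ i ∈ Finset.range (N + 1), 1 := Finset.sum_le_sum fun i _ => hfB j _
      _ = N + 1 := by simp
  have hvar : Var[g N; P] ≤ (N + 1 : ℕ) * ∫ x, c x ^ 2 ∂μ := by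
    have := variance_weighted_sum_abs_le (fun i => (hmeas i).measurable) hindep hlaw J hw hf hfB
      hc hcint (N + 1) 0
    refine le_trans (le_of_eq ?_) this
    congr 1
    funext ω
    simp [g, deviationNorm, f]
  have hM' : P[g N] ≤ M := hM
  calc P {ω | ∃ k, 1 ≤ k ∧ k ≤ N + 1 ∧ ε ≤ deviationNorm μ X J w A k ω}
      ≤ P {ω | ∃ k ≤ N, ε ≤ g k ω} := by
        refine measure_mono fun ω hω => ?_
        obtain ⟨k, h1, h2, h3⟩ := hω
        refine ⟨k - 1, by omega, ?_⟩
        have : k - 1 + 1 = k := by omega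
        simpa only [g, this] using h3
    _ ≤ ENNReal.ofReal (Var[g N; P] / (ε - P[g N]) ^ 2) :=
        measure_exists_le_submartingale_le hsub hg0 N hgL (hM'.trans_lt hε)
    _ ≤ _ := by
      refine ENNReal.ofReal_le_ofReal ?_
      have h0 : 0 < ε - M := by linarith
      have h1 : 0 ≤ ∫ x, c x ^ 2 ∂μ := integral_nonneg fun x => sq_nonneg _
      gcongr

/-- The mean absolute deviation of an empirical count. -/
lemma integral_abs_sum_indicator_sub_le {Ω E : Type*} [MeasurableSpace Ω] [MeasurableSpace E]
    {P : Measure Ω} [IsProbabilityMeasure P] {μ : Measure E} [IsProbabilityMeasure μ]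
    {X : ℕ → Ω → E} (hmeas : ∀ i, Measurable (X i)) (hindep : iIndepFun X P)
    (hlaw : ∀ i, P.map (X i) = μ) {A : Set E} (hA : MeasurableSet A) (n : ℕ) :
    ∫ ω, |∑ i ∈ Finset.range n, (A.indicator 1 (X i ω) - μ.real A)| ∂P ≤ √(n * μ.real A) ∧
    ∫ ω, |∑ i ∈ Finset.range n, (A.indicator 1 (X i ω) - μ.real A)| ∂P ≤ 2 * (n * μ.real A) := by
  have hind : Measurable (A.indicator (1 : E → ℝ)) := measurable_const.indicator hA
  have hY : ∀ i, Measurable fun ω => A.indicator (1 : E → ℝ) (X i ω) := fun i => hind.comp (hmeas i)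
  have h0 : 0 ≤ μ.real A := measureReal_nonneg
  have h1 : μ.real A ≤ 1 := measureReal_le_one
  have hind01 : ∀ x, 0 ≤ A.indicator (1 : E → ℝ) x ∧ A.indicator (1 : E → ℝ) x ≤ 1 := by
    intro x
    by_cases hx : x ∈ A <;> simp [hx]
  have hYB : ∀ i ω, |A.indicator (1 : E → ℝ) (X i ω)| ≤ 1 := fun i ω => by
    rw [abs_of_nonneg (hind01 _).1]
    exact (hind01 _).2
  have hYint : ∀ i, Integrable (fun ω => A.indicator (1 : E → ℝ) (X i ω)) P := fun i =>
    integrable_of_abs_le (hY i) (hYB i)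
  have hYE : ∀ i, ∫ ω, A.indicator (1 : E → ℝ) (X i ω) ∂P = μ.real A := by
    intro i
    rw [← integral_indicator_one hA, ← hlaw i, integral_map (hmeas i).aemeasurable
      hind.aestronglyMeasurable]
  constructor
  · set S : Ω → ℝ := fun ω => ∑ i ∈ Finset.range n, (A.indicator 1 (X i ω) - μ.real A) with hS
    have hSm : Measurable S := Finset.measurable_fun_sum _ fun i _ => (hY i).sub measurable_const
    have hSB : ∀ ω, |S ω| ≤ n * 2 := by
      intro ω
      calc _ ≤ ∑ i ∈ Finset.range n, |A.indicator (1 : E → ℝ) (X i ω) - μ.real A| :=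
            Finset.abs_sum_le_sum_abs _ _
        _ ≤ ∑ i ∈ Finset.range n, 2 := Finset.sum_le_sum fun i _ => by
            have := abs_sub (A.indicator (1 : E → ℝ) (X i ω)) (μ.real A)
            rw [abs_of_nonneg h0] at this
            linarith [hYB i ω]
        _ = n * 2 := by simp
    have hSL : MemLp S 2 P := memLp_two_of_abs_le hSm hSB
    have hS0 : P[S] = 0 := by
      have hi : ∀ i ∈ Finset.range n,
          Integrable (fun ω => A.indicator (1 : E → ℝ) (X i ω) - μ.real A) P :=
        fun i _ => (hYint i).sub (integrable_const _)
      simp only [hS]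
      rw [integral_finsetSum _ hi]
      refine Finset.sum_eq_zero fun i _ => ?_
      rw [integral_sub (hYint i) (integrable_const _), hYE]
      simp
    have hSvar : Var[S; P] ≤ n * μ.real A := by
      have e : S = fun ω => (∑ i ∈ Finset.range n, fun ω => A.indicator (1 : E → ℝ) (X i ω)) ω
          - n * μ.real A := by
        funext ω
        simp [hS]
      rw [e, variance_sub_const, IndepFun.variance_sum]
      · calc _ ≤ ∑ i ∈ Finset.range n, μ.real A := Finset.sum_le_sum fun i _ => by
              refine (variance_le_expectation_sq (hY i).aestronglyMeasurable).trans (le_of_eq ?_)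
              rw [← hYE i]
              congr 1
              funext ω
              simp only [Pi.pow_apply]
              by_cases hx : X i ω ∈ A <;> simp [hx]
          _ = n * μ.real A := by simp
      · exact fun i _ => memLp_two_of_abs_le (hY i) (hYB i)
      · intro i _ j _ hij
        exact (hindep.indepFun hij).comp hind hind
      · exact Finset.aestronglyMeasurable_sum _ fun i _ => (hY i).aestronglyMeasurable
    refine Real.le_sqrt_of_sq_le (le_trans ?_ hSvar)
    have hv := variance_nonneg (fun ω => |S ω|) P
    rw [variance_eq_sub (show MemLp (fun ω => |S ω|) 2 P from hSL.abs)] at hv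
    rw [variance_eq_sub hSL, hS0]
    have : ((fun ω => |S ω|) ^ 2 : Ω → ℝ) = S ^ 2 := by
      funext ω
      simp
    rw [this] at hv
    linarith
  · calc _ ≤ ∫ ω, ∑ i ∈ Finset.range n, (A.indicator (1 : E → ℝ) (X i ω) + μ.real A) ∂P := by
          refine integral_mono_of_nonneg (ae_of_all _ fun ω => abs_nonneg _)
            (integrable_finsetSum _ fun i _ => (hYint i).add (integrable_const _))
            (ae_of_all _ fun ω => ?_)
          refine (Finset.abs_sum_le_sum_abs _ _).trans (Finset.sum_le_sum fun i _ => ?_)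
          refine (abs_sub _ _).trans (le_of_eq ?_)
          rw [abs_of_nonneg (hind01 _).1, abs_of_nonneg h0]
      _ = 2 * (n * μ.real A) := by
        have hi : ∀ i ∈ Finset.range n,
            Integrable (fun ω => A.indicator (1 : E → ℝ) (X i ω) + μ.real A) P :=
          fun i _ => (hYint i).add (integrable_const _)
        rw [integral_finsetSum _ hi]
        simp only [integral_add (hYint _) (integrable_const _), hYE]
        simp
        ring

lemma sum_pow_le_of_forall_pow_le {b y : ℝ} (hb : 1 < b) (hy : 0 ≤ y) (S : Finset ℕ)
    (h : ∀ m ∈ S, b ^ m ≤ y) : ∑ m ∈ S, b ^ m ≤ y * (b / (b - 1)) := by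
  have hb' : 0 < b - 1 := by linarith
  have hb0 : 0 < b := by linarith
  rcases S.eq_empty_or_nonempty with rfl | hS
  · simp only [Finset.sum_empty]
    positivity
  set M := S.max' hS
  calc ∑ m ∈ S, b ^ m ≤ ∑ m ∈ Finset.range (M + 1), b ^ m := by
        refine Finset.sum_le_sum_of_subset_of_nonneg (fun m hm => ?_) fun _ _ _ => by positivity
        exact Finset.mem_range.2 (Nat.lt_succ_of_le (S.le_max' m hm))
    _ = (b ^ (M + 1) - 1) / (b - 1) := geom_sum_eq hb.ne' _
    _ ≤ b ^ M * (b / (b - 1)) := by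
      rw [mul_div, ← pow_succ]
      gcongr
      linarith
    _ ≤ _ := by
      gcongr
      exact h M (S.max'_mem hS)

lemma sum_inv_pow_le_of_forall_le_pow {b y : ℝ} (hb : 1 < b) (hy : 0 < y) (S : Finset ℕ)
    (h : ∀ m ∈ S, y ≤ b ^ m) : ∑ m ∈ S, (b ^ m)⁻¹ ≤ y⁻¹ * (b / (b - 1)) := by
  have hb' : 0 < b - 1 := by linarith
  have hb0 : 0 < b := by linarith
  rcases S.eq_empty_or_nonempty with rfl | hS
  · simp only [Finset.sum_empty]
    positivity
  set M := S.max' hS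
  set m₀ := S.min' hS
  calc ∑ m ∈ S, (b ^ m)⁻¹ = ∑ m ∈ S, b⁻¹ ^ m := by simp only [inv_pow]
    _ ≤ ∑ m ∈ Finset.Ico m₀ (M + 1), b⁻¹ ^ m := by
        refine Finset.sum_le_sum_of_subset_of_nonneg (fun m hm => ?_) fun _ _ _ => by positivity
        exact Finset.mem_Ico.2 ⟨S.min'_le m hm, Nat.lt_succ_of_le (S.le_max' m hm)⟩
    _ ≤ b⁻¹ ^ m₀ / (1 - b⁻¹) :=
        geom_sum_Ico_le_of_lt_one (by positivity) (inv_lt_one_of_one_lt₀ hb)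
    _ = (b ^ m₀)⁻¹ * (b / (b - 1)) := by
      rw [inv_pow]
      field_simp
    _ ≤ _ := by
      gcongr
      exact h m₀ (S.min'_mem hS)

lemma min_le_rpow_mul_rpow {a b t : ℝ} (ha : 0 ≤ a) (hb : 0 ≤ b) (ht : 0 ≤ t) (ht1 : t ≤ 1) :
    min a b ≤ a ^ t * b ^ (1 - t) := by
  have hm : 0 ≤ min a b := le_min ha hb
  rcases hm.eq_or_lt with h | h
  · rw [← h]
    positivity
  calc min a b = min a b ^ t * min a b ^ (1 - t) := by
        rw [← Real.rpow_add h]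
        simp
    _ ≤ _ := by
      have : 0 ≤ 1 - t := by linarith
      gcongr
      · exact min_le_left _ _
      · exact min_le_right _ _

/-- Summation over the levels: interpolation between the two bounds for the deviations. -/
lemma exists_sum_level_le_of_lt (d : ℕ) {p γ : ℝ} (hγ : 1 / 2 ≤ γ) (hγ1 : γ ≤ 1)
    (hp : d * (1 - γ) < p) : ∃ C : ℝ, 0 ≤ C ∧ ∀ (N : ℕ) (Q : ℝ), 0 ≤ Q →
      ∑ l ∈ Finset.range N, (2 : ℝ) ^ (-(p * l)) * min (√((2 ^ l) ^ d * Q)) Q ≤ C * Q ^ γ := by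
  set b : ℝ := 2 ^ (p - d * (1 - γ)) with hb
  have hb1 : 1 < b := Real.one_lt_rpow (by norm_num) (by linarith)
  refine ⟨b / (b - 1), div_nonneg (by linarith) (by linarith), fun N Q hQ => ?_⟩
  have h1 : ∀ l : ℕ, (2 : ℝ) ^ (-(p * l)) * min (√((2 ^ l) ^ d * Q)) Q ≤ (b ^ l)⁻¹ * Q ^ γ := by
    intro l
    have h2 := min_le_rpow_mul_rpow (Real.sqrt_nonneg ((2 ^ l) ^ d * Q)) hQ
      (t := 2 * (1 - γ)) (by linarith) (by linarith)
    rcases hQ.eq_or_lt with h0 | h0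
    · subst h0
      simp only [mul_zero, Real.sqrt_zero, min_self]
      positivity
    have e1 : √((2 ^ l) ^ d * Q) ^ (2 * (1 - γ)) * Q ^ (1 - 2 * (1 - γ))
        = (2 : ℝ) ^ (l * (d * (1 - γ))) * Q ^ γ := by
      rw [Real.sqrt_eq_rpow, ← Real.rpow_mul (by positivity),
        Real.mul_rpow (by positivity) hQ, mul_assoc, ← Real.rpow_add h0, ← pow_mul,
        ← Real.rpow_natCast_mul (by norm_num)]
      congr 2
      · push_cast
        ring
      · ring
    rw [e1] at h2
    calc _ ≤ (2 : ℝ) ^ (-(p * l)) * ((2 : ℝ) ^ (l * (d * (1 - γ))) * Q ^ γ) := by gcongr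
      _ = _ := by
        rw [← mul_assoc, ← Real.rpow_add (by norm_num), hb, ← Real.rpow_mul_natCast (by norm_num),
          ← Real.rpow_neg (by norm_num)]
        congr 2
        ring
  calc _ ≤ ∑ l ∈ Finset.range N, (b ^ l)⁻¹ * Q ^ γ := Finset.sum_le_sum fun l _ => h1 l
    _ = (∑ l ∈ Finset.range N, (b ^ l)⁻¹) * Q ^ γ := by rw [Finset.sum_mul]
    _ ≤ _ := by
      gcongr
      have := sum_inv_pow_le_of_forall_le_pow hb1 one_pos (Finset.range N)
        fun m _ => one_le_pow₀ hb1.le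
      simpa using this

/-- Summation over the levels in the case of a high dimension. -/
lemma exists_sum_level_le_of_gt {d : ℕ} {p : ℝ} (hp : 0 < p) (hpd : p < d / 2) :
    ∃ C : ℝ, 0 ≤ C ∧ ∀ (N : ℕ) (Q : ℝ), 0 ≤ Q →
      ∑ l ∈ Finset.range N, (2 : ℝ) ^ (-(p * l)) * min (√((2 ^ l) ^ d * Q)) Q ≤
        C * Q ^ ((d - p) / d) := by
  have hd : (0 : ℝ) < d := by linarith
  set b₁ : ℝ := 2 ^ (d / 2 - p) with hb₁
  set b₂ : ℝ := 2 ^ p with hb₂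
  have h₁ : 1 < b₁ := Real.one_lt_rpow (by norm_num) (by linarith)
  have h₂ : 1 < b₂ := Real.one_lt_rpow (by norm_num) hp
  have c₁ : 0 ≤ b₁ / (b₁ - 1) := div_nonneg (by linarith) (by linarith)
  have c₂ : 0 ≤ b₂ / (b₂ - 1) := div_nonneg (by linarith) (by linarith)
  refine ⟨b₁ / (b₁ - 1) + b₂ / (b₂ - 1), by positivity, fun N Q hQ => ?_⟩
  rcases hQ.eq_or_lt with h0 | h0
  · subst h0
    simp only [mul_zero, Real.sqrt_zero, min_self, Finset.sum_const_zero]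
    positivity
  rw [← Finset.sum_filter_add_sum_filter_not _ (fun l : ℕ => ((2 : ℝ) ^ l) ^ d ≤ Q), add_mul]
  have hdl : ∀ (l : ℕ) (x : ℝ), ((((2 : ℝ) ^ l) ^ d) ^ (x / d)) = 2 ^ (x * l) := by
    intro l x
    rw [← Real.rpow_natCast_mul (by positivity), mul_div_cancel₀ _ hd.ne',
      ← Real.rpow_natCast_mul (by norm_num), mul_comm]
  refine add_le_add ?_ ?_
  · calc _ ≤ ∑ l ∈ Finset.range N with ((2 : ℝ) ^ l) ^ d ≤ Q, b₁ ^ l * Q ^ (1 / 2 : ℝ) := by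
          refine Finset.sum_le_sum fun l _ => ?_
          calc _ ≤ (2 : ℝ) ^ (-(p * l)) * √((2 ^ l) ^ d * Q) := by
                gcongr
                exact min_le_left _ _
            _ = _ := by
              rw [Real.sqrt_eq_rpow, Real.mul_rpow (by positivity) hQ, ← mul_assoc]
              congr 1
              rw [hb₁, ← Real.rpow_mul_natCast (by norm_num), ← pow_mul,
                ← Real.rpow_natCast_mul (by norm_num), ← Real.rpow_add (by norm_num)]
              congr 1
              push_cast
              ring
      _ = (∑ l ∈ Finset.range N with ((2 : ℝ) ^ l) ^ d ≤ Q, b₁ ^ l) * Q ^ (1 / 2 : ℝ) := by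
          rw [Finset.sum_mul]
      _ ≤ Q ^ ((d / 2 - p) / d) * (b₁ / (b₁ - 1)) * Q ^ (1 / 2 : ℝ) := by
          gcongr
          refine sum_pow_le_of_forall_pow_le h₁ (by positivity) _ fun l hl => ?_
          have hl' := (Finset.mem_filter.1 hl).2
          rw [hb₁, ← Real.rpow_mul_natCast (by norm_num), ← hdl]
          refine Real.rpow_le_rpow (by positivity) hl' (div_nonneg (by linarith) hd.le)
      _ = _ := by
          rw [mul_comm (Q ^ _), mul_assoc, ← Real.rpow_add h0]
          congr 2
          field_simp
          ring
  · calc _ ≤ ∑ l ∈ Finset.range N with ¬ ((2 : ℝ) ^ l) ^ d ≤ Q, (b₂ ^ l)⁻¹ * Q := by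
          refine Finset.sum_le_sum fun l _ => ?_
          rw [hb₂, ← Real.rpow_mul_natCast (by norm_num), ← Real.rpow_neg (by norm_num)]
          gcongr
          exact min_le_right _ _
      _ = (∑ l ∈ Finset.range N with ¬ ((2 : ℝ) ^ l) ^ d ≤ Q, (b₂ ^ l)⁻¹) * Q := by
          rw [Finset.sum_mul]
      _ ≤ (Q ^ (p / d))⁻¹ * (b₂ / (b₂ - 1)) * Q := by
          gcongr
          refine sum_inv_pow_le_of_forall_le_pow h₂ (by positivity) _ fun l hl => ?_
          have hl' := (Finset.mem_filter.1 hl).2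
          rw [hb₂, ← Real.rpow_mul_natCast (by norm_num), ← hdl]
          exact Real.rpow_le_rpow hQ (not_le.1 hl').le (by positivity)
      _ = _ := by
          rw [← Real.rpow_neg hQ, mul_comm (Q ^ _), mul_assoc]
          conv_lhs => rw [← Real.rpow_one Q]
          rw [← Real.rpow_mul hQ, ← Real.rpow_add h0]
          congr 2
          field_simp
          ring

/-- The mass of a dyadic shell. -/
noncomputable def shellMass {d : ℕ} (μ : Measure (EuclideanSpace ℝ (Fin d))) (m : ℕ) : ℝ :=
  μ.real {x | dyadicShell x = m}

/-- Bound for the mean of the weighted deviations, in terms of the masses of the shells. -/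
theorem integral_deviationNorm_le {d : ℕ} {Ω : Type*} [MeasurableSpace Ω]
    {P : Measure Ω} [IsProbabilityMeasure P] {μ : Measure (EuclideanSpace ℝ (Fin d))}
    [IsProbabilityMeasure μ] {X : ℕ → Ω → EuclideanSpace ℝ (Fin d)}
    (hmeas : ∀ i, Measurable (X i)) (hindep : iIndepFun X P)
    (hlaw : ∀ i, P.map (X i) = μ) (p : ℝ) (N : ℕ) (S : Finset ℕ) (n : ℕ) :
    ∫ ω, deviationNorm μ X (dyadicIndex d N S) (cellWeight p) cellSet n ω ∂P ≤
      2 * 3 ^ d * ∑ m ∈ S, 2 ^ (p * m) * ∑ l ∈ Finset.range N, (2 : ℝ) ^ (-(p * l)) *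
        min (√((2 ^ l) ^ d * (n * shellMass μ m))) (n * shellMass μ m) := by
  have hint : ∀ j : (Σ _ : ℕ, ℕ × (Fin d → ℤ)), Integrable (fun ω => |∑ i ∈ Finset.range n,
      ((cellSet j).indicator 1 (X i ω) - μ.real (cellSet j))|) P := by
    intro j
    refine Integrable.abs (integrable_finsetSum _ fun i _ => Integrable.sub ?_ (integrable_const _))
    exact ((integrable_const (1 : ℝ)).indicator (hmeas i (measurableSet_cellSet j)) :
      Integrable ((X i ⁻¹' cellSet j).indicator fun _ => (1 : ℝ)) P)
  have hmass : ∀ (l m : ℕ), ∑ F ∈ dyadicBox d l, μ.real (cellSet ⟨l, (m, F)⟩) ≤ shellMass μ m := by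
    intro l m
    rw [← measureReal_biUnion_finset]
    · refine measureReal_mono ?_
      intro x hx
      simp only [Set.mem_iUnion] at hx
      obtain ⟨F, -, hF⟩ := hx
      exact congrArg Prod.fst hF
    · intro F _ G _ hFG
      rw [Function.onFun, Set.disjoint_left]
      intro x hx hx'
      have hx1 : dyadicCell l x = (m, F) := hx
      have hx2 : dyadicCell l x = (m, G) := hx'
      rw [hx1] at hx2
      exact hFG (congrArg Prod.snd hx2)
    · exact fun F _ => measurableSet_cellSet _
  have hn0 : (0 : ℝ) ≤ n := Nat.cast_nonneg n
  have h3d : (1 : ℝ) ≤ 3 ^ d := one_le_pow₀ (by norm_num)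
  have hcell : ∀ l m : ℕ, ∑ F ∈ dyadicBox d l, ∫ ω, |∑ i ∈ Finset.range n,
      ((cellSet ⟨l, (m, F)⟩).indicator 1 (X i ω) - μ.real (cellSet ⟨l, (m, F)⟩))| ∂P ≤
      2 * 3 ^ d * min (√((2 ^ l) ^ d * (n * shellMass μ m))) (n * shellMass μ m) := by
    intro l m
    have hq : 0 ≤ n * shellMass μ m := mul_nonneg hn0 measureReal_nonneg
    rw [mul_min_of_nonneg _ _ (by positivity)]
    refine le_min ?_ ?_
    · calc _ ≤ ∑ F ∈ dyadicBox d l, √(n * μ.real (cellSet ⟨l, (m, F)⟩)) :=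
            Finset.sum_le_sum fun F _ => (integral_abs_sum_indicator_sub_le hmeas hindep hlaw
              (measurableSet_cellSet _) n).1
        _ ≤ √((dyadicBox d l).card * ∑ F ∈ dyadicBox d l,
              (n * μ.real (cellSet ⟨l, (m, F)⟩))) := by
            refine Real.le_sqrt_of_sq_le (sq_sum_le_card_mul_sum_sq.trans (le_of_eq ?_))
            congr 1
            exact Finset.sum_congr rfl fun F _ =>
              Real.sq_sqrt (mul_nonneg hn0 measureReal_nonneg)
        _ ≤ √((3 ^ d) ^ 2 * ((2 ^ l) ^ d * (n * shellMass μ m))) := by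
            refine Real.sqrt_le_sqrt ?_
            rw [← Finset.mul_sum]
            calc _ ≤ (3 ^ d * (2 ^ l) ^ d) * (n * shellMass μ m) := by
                  gcongr
                  · exact card_dyadicBox_le d l
                  · exact hmass l m
              _ ≤ (3 ^ d * 3 ^ d * (2 ^ l) ^ d) * (n * shellMass μ m) := by
                  gcongr
                  nlinarith
              _ = _ := by ring
        _ = 3 ^ d * √((2 ^ l) ^ d * (n * shellMass μ m)) := by
            rw [Real.sqrt_mul (by positivity), Real.sqrt_sq (by positivity)]
        _ ≤ _ := by
            gcongr
            linarith
    · calc _ ≤ ∑ F ∈ dyadicBox d l, 2 * (n * μ.real (cellSet ⟨l, (m, F)⟩)) :=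
            Finset.sum_le_sum fun F _ => (integral_abs_sum_indicator_sub_le hmeas hindep hlaw
              (measurableSet_cellSet _) n).2
        _ = 2 * (n * ∑ F ∈ dyadicBox d l, μ.real (cellSet ⟨l, (m, F)⟩)) := by
            simp only [Finset.mul_sum]
        _ ≤ 2 * (n * shellMass μ m) := by
            gcongr
            exact hmass l m
        _ ≤ _ := by
            gcongr
            linarith
  calc _ = ∑ j ∈ dyadicIndex d N S, cellWeight p j * ∫ ω, |∑ i ∈ Finset.range n,
      ((cellSet j).indicator 1 (X i ω) - μ.real (cellSet j))| ∂P := by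
        simp only [deviationNorm]
        rw [integral_finsetSum _ fun j _ => (hint j).const_mul _]
        simp only [integral_const_mul]
    _ = ∑ l ∈ Finset.range N, ∑ m ∈ S, (2 ^ (-(p * l)) * 2 ^ (p * m)) *
        ∑ F ∈ dyadicBox d l, ∫ ω, |∑ i ∈ Finset.range n,
        ((cellSet ⟨l, (m, F)⟩).indicator 1 (X i ω) - μ.real (cellSet ⟨l, (m, F)⟩))| ∂P := by
        rw [dyadicIndex, Finset.sum_sigma]
        refine Finset.sum_congr rfl fun l _ => ?_
        rw [Finset.sum_product]
        simp only [Finset.mul_sum, cellWeight]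
    _ ≤ ∑ l ∈ Finset.range N, ∑ m ∈ S, (2 ^ (-(p * l)) * 2 ^ (p * m)) *
        (2 * 3 ^ d * min (√((2 ^ l) ^ d * (n * shellMass μ m))) (n * shellMass μ m)) := by
        refine Finset.sum_le_sum fun l _ => Finset.sum_le_sum fun m _ => ?_
        exact mul_le_mul_of_nonneg_left (hcell l m) (by positivity)
    _ = _ := by
        rw [Finset.sum_comm]
        simp only [Finset.mul_sum]
        refine Finset.sum_congr rfl fun m _ => Finset.sum_congr rfl fun l _ => ?_
        ring

/-- The dyadic shells on which the moment weight is at most `T`. -/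
noncomputable def shellRange (p T : ℝ) : Finset ℕ :=
  (Finset.range (⌊T⌋₊ + 1)).filter fun m => (2 : ℝ) ^ (p * m) ≤ T

lemma mem_shellRange {p : ℝ} (hp : 1 ≤ p) {T : ℝ} {m : ℕ} :
    m ∈ shellRange p T ↔ (2 : ℝ) ^ (p * m) ≤ T := by
  simp only [shellRange, Finset.mem_filter, Finset.mem_range, Nat.lt_succ_iff, and_iff_right_iff_imp]
  intro h
  refine Nat.le_floor (le_trans ?_ h)
  calc (m : ℝ) ≤ 2 ^ m := by exact_mod_cast (Nat.lt_two_pow_self).le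
    _ = (2 : ℝ) ^ (m : ℝ) := (Real.rpow_natCast _ _).symm
    _ ≤ _ := Real.rpow_le_rpow_of_exponent_le (by norm_num)
      (by nlinarith [Nat.cast_nonneg (α := ℝ) m])

lemma integrable_shellWeight_rpow {d : ℕ} {p r : ℝ} (hrp : 0 < r * p)
    {μ : Measure (EuclideanSpace ℝ (Fin d))} [IsProbabilityMeasure μ]
    (hmom : strongMoment (r * p) μ < ∞) : Integrable (fun x => shellWeight p x ^ r) μ := by
  have hm : Measurable fun x : EuclideanSpace ℝ (Fin d) => shellWeight p x ^ r :=
    (measurable_shellWeight p).pow_const r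
  refine ⟨hm.aestronglyMeasurable, ?_⟩
  have hbound : ∀ x : EuclideanSpace ℝ (Fin d), ‖shellWeight p x ^ r‖ₑ ≤
      ENNReal.ofReal (4 ^ (r * p)) * (1 + ‖(WithLp.ofLp x : Fin d → ℝ)‖ₑ ^ (r * p)) := by
    intro x
    set a := ‖(WithLp.ofLp x : Fin d → ℝ)‖ with ha
    have ha0 : 0 ≤ a := norm_nonneg _
    have h1 : shellWeight p x ^ r ≤ 4 ^ (r * p) * (1 + a ^ (r * p)) := by
      rw [shellWeight_rpow, shellWeight, two_rpow_mul_natCast]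
      calc _ ≤ (4 * max 1 a) ^ (r * p) := by
            refine Real.rpow_le_rpow (by positivity) ?_ hrp.le
            have := two_pow_dyadicShell_le x
            rw [← ha] at this
            linarith [le_max_left 1 a, le_max_right 1 a]
        _ = 4 ^ (r * p) * (max 1 a) ^ (r * p) :=
            Real.mul_rpow (by norm_num) (by positivity)
        _ ≤ _ := by
            gcongr
            have h2 : 0 ≤ a ^ (r * p) := by positivity
            rcases le_total 1 a with h | h
            · rw [max_eq_right h]
              linarith
            · rw [max_eq_left h, Real.one_rpow]
              linarith
    rw [Real.enorm_of_nonneg (Real.rpow_nonneg (shellWeight_pos p x).le r)]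
    refine (ENNReal.ofReal_le_ofReal h1).trans (le_of_eq ?_)
    rw [ENNReal.ofReal_mul (by positivity), ENNReal.ofReal_add (by norm_num) (by positivity),
      ENNReal.ofReal_one, ← ENNReal.ofReal_rpow_of_nonneg ha0 hrp.le, ha, ofReal_norm]
  refine (lintegral_mono hbound).trans_lt ?_
  have hmn : Measurable fun x : EuclideanSpace ℝ (Fin d) =>
      ‖(WithLp.ofLp x : Fin d → ℝ)‖ₑ ^ (r * p) :=
    ((PiLp.continuous_ofLp 2 _).measurable.enorm).pow_const _
  have hmn1 : Measurable fun x : EuclideanSpace ℝ (Fin d) =>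
      1 + ‖(WithLp.ofLp x : Fin d → ℝ)‖ₑ ^ (r * p) := measurable_const.add hmn
  rw [lintegral_const_mul _ hmn1, lintegral_add_left measurable_const]
  refine ENNReal.mul_lt_top ENNReal.ofReal_lt_top (ENNReal.add_lt_top.2 ⟨by simp, hmom⟩)

lemma integrable_shellWeight {d : ℕ} {p r : ℝ} (hp : 0 ≤ p) (hr : 1 ≤ r)
    {μ : Measure (EuclideanSpace ℝ (Fin d))}
    (hint : Integrable (fun x => shellWeight p x ^ r) μ) : Integrable (shellWeight p) μ := by
  refine hint.mono' (measurable_shellWeight p).aestronglyMeasurable (ae_of_all _ fun x => ?_)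
  rw [Real.norm_of_nonneg (shellWeight_pos p x).le]
  exact Real.self_le_rpow_of_one_le (one_le_shellWeight hp x) hr

lemma measurableSet_dyadicShell_eq {d : ℕ} (m : ℕ) :
    MeasurableSet {x : EuclideanSpace ℝ (Fin d) | dyadicShell x = m} :=
  measurable_dyadicShell (measurableSet_singleton m)

lemma tendsto_shellMass {d : ℕ} {p r : ℝ} {μ : Measure (EuclideanSpace ℝ (Fin d))}
    (hint : Integrable (fun x => shellWeight p x ^ r) μ) :
    Filter.Tendsto (fun m : ℕ => (2 : ℝ) ^ (r * p * m) * shellMass μ m) Filter.atTop (nhds 0) := by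
  have h := hasSum_integral_iUnion (f := fun x => shellWeight p x ^ r) (μ := μ)
    (s := fun m : ℕ => {x : EuclideanSpace ℝ (Fin d) | dyadicShell x = m})
    measurableSet_dyadicShell_eq
    (by
      intro i j hij
      rw [Function.onFun, Set.disjoint_left]
      intro x hx hx'
      exact hij (hx.symm.trans hx')) hint.integrableOn
  refine h.summable.tendsto_atTop_zero.congr fun m => ?_
  rw [setIntegral_congr_fun (g := fun _ => (2 : ℝ) ^ (r * p * m)) (measurableSet_dyadicShell_eq m)
    (by
      intro x hx
      simp only [Set.mem_ofPred_eq] at hx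
      change shellWeight p x ^ r = _
      rw [shellWeight_rpow, shellWeight, hx])]
  rw [setIntegral_const, smul_eq_mul, mul_comm]
  rfl

lemma setOf_dyadicShell_notMem_shellRange {d : ℕ} {p : ℝ} (hp : 1 ≤ p) (T : ℝ) :
    {x : EuclideanSpace ℝ (Fin d) | dyadicShell x ∉ shellRange p T} = {x | T < shellWeight p x} := by
  ext x
  simp [mem_shellRange hp, shellWeight]

lemma eventually_const_mul_rpow_le {γ α : ℝ} (h : γ < α) (K : ℝ) {ε : ℝ} (hε : 0 < ε) :
    ∀ᶠ n : ℕ in Filter.atTop, K * (n : ℝ) ^ γ ≤ ε * (n : ℝ) ^ α := by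
  have h1 : Filter.Tendsto (fun n : ℕ => K * (n : ℝ) ^ (-(α - γ))) Filter.atTop (nhds (K * 0)) :=
    ((tendsto_rpow_neg_atTop (by linarith)).comp tendsto_natCast_atTop_atTop).const_mul K
  rw [mul_zero] at h1
  filter_upwards [h1.eventually (gt_mem_nhds hε), Filter.eventually_ge_atTop 1] with n hn hn1
  have hn0 : (0 : ℝ) < n := by exact_mod_cast hn1
  calc K * (n : ℝ) ^ γ = (K * (n : ℝ) ^ (-(α - γ))) * (n : ℝ) ^ α := by
        rw [mul_assoc, ← Real.rpow_add hn0]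
        congr 2
        ring
    _ ≤ _ := by gcongr

/-- The part of the cost outside of the truncation set is negligible. -/
lemma eventually_mul_setIntegral_shellWeight_le {d : ℕ} {p r α : ℝ} (hp : 1 ≤ p) (hr : 1 ≤ r)
    (hα : 0 < α) (hαr : 1 ≤ α * r) {μ : Measure (EuclideanSpace ℝ (Fin d))} [IsFiniteMeasure μ]
    (hint : Integrable (fun x => shellWeight p x ^ r) μ) {ε : ℝ} (hε : 0 < ε) :
    ∀ᶠ n : ℕ in Filter.atTop, (n : ℝ) *
      ∫ x in {x | (n : ℝ) ^ α < shellWeight p x}, shellWeight p x ∂μ ≤ ε * (n : ℝ) ^ α := by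
  have hms : ∀ n : ℕ, MeasurableSet {x : EuclideanSpace ℝ (Fin d) |
      (n : ℝ) ^ α < shellWeight p x} := fun n =>
    measurableSet_lt measurable_const (measurable_shellWeight p)
  have htend := tendsto_setIntegral_of_antitone (μ := μ) (f := fun x => shellWeight p x ^ r)
    (s := fun n : ℕ => {x : EuclideanSpace ℝ (Fin d) | (n : ℝ) ^ α < shellWeight p x})
    hms
    (by
      intro n m hnm x hx
      simp only [Set.mem_ofPred_eq] at hx ⊢
      refine lt_of_le_of_lt ?_ hx
      gcongr) ⟨0, hint.integrableOn⟩
  have hempty : (⋂ n : ℕ, {x : EuclideanSpace ℝ (Fin d) | (n : ℝ) ^ α < shellWeight p x}) = ∅ := by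
    refine Set.eq_empty_of_forall_notMem fun x hx => ?_
    have h1 : Filter.Tendsto (fun n : ℕ => (n : ℝ) ^ α) Filter.atTop Filter.atTop :=
      (tendsto_rpow_atTop hα).comp tendsto_natCast_atTop_atTop
    obtain ⟨n, hn⟩ := (h1.eventually_ge_atTop (shellWeight p x)).exists
    have := Set.mem_iInter.1 hx n
    simp only [Set.mem_ofPred_eq] at this
    linarith
  rw [hempty, setIntegral_empty] at htend
  filter_upwards [htend.eventually (gt_mem_nhds hε), Filter.eventually_ge_atTop 1] with n hn hn1
  have hn1' : (1 : ℝ) ≤ n := by exact_mod_cast hn1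
  have hn0 : (0 : ℝ) < n := by linarith
  have hT : (0 : ℝ) < (n : ℝ) ^ α := by positivity
  have h2 : ∫ x in {x | (n : ℝ) ^ α < shellWeight p x}, shellWeight p x ∂μ ≤
      ∫ x in {x | (n : ℝ) ^ α < shellWeight p x},
        ((n : ℝ) ^ α) ^ (1 - r) * shellWeight p x ^ r ∂μ := by
    refine setIntegral_mono_on (integrable_shellWeight (by linarith) hr hint).integrableOn
      (hint.const_mul _).integrableOn (hms n) fun x hx => ?_
    simp only [Set.mem_ofPred_eq] at hx
    have h3 := shellWeight_pos p x
    calc shellWeight p x = shellWeight p x ^ (1 - r) * shellWeight p x ^ r := by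
          rw [← Real.rpow_add h3]
          simp
      _ ≤ _ := by
          refine mul_le_mul_of_nonneg_right ?_ (by positivity)
          exact Real.rpow_le_rpow_of_nonpos hT hx.le (by linarith)
  rw [integral_const_mul] at h2
  set I := ∫ x in {x | (n : ℝ) ^ α < shellWeight p x}, shellWeight p x ^ r ∂μ with hI
  have hI0 : 0 ≤ I := integral_nonneg fun x => Real.rpow_nonneg (shellWeight_pos p x).le r
  calc (n : ℝ) * ∫ x in {x | (n : ℝ) ^ α < shellWeight p x}, shellWeight p x ∂μ
      ≤ n * (((n : ℝ) ^ α) ^ (1 - r) * I) := by gcongr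
    _ = (n : ℝ) ^ (1 + α * (1 - r)) * I := by
      rw [← Real.rpow_mul hn0.le, ← mul_assoc, Real.rpow_add hn0, Real.rpow_one]
    _ ≤ (n : ℝ) ^ α * ε := by
      refine mul_le_mul (Real.rpow_le_rpow_of_exponent_le hn1' (by linarith)) hn.le hI0 hT.le
    _ = _ := mul_comm _ _

lemma shellMass_nonneg {d : ℕ} {μ : Measure (EuclideanSpace ℝ (Fin d))} (m : ℕ) :
    0 ≤ shellMass μ m :=
  measureReal_nonneg

section mean

variable {d : ℕ} {Ω : Type*} [MeasurableSpace Ω]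
  {P : Measure Ω} [IsProbabilityMeasure P] {μ : Measure (EuclideanSpace ℝ (Fin d))}
  [IsProbabilityMeasure μ] {X : ℕ → Ω → EuclideanSpace ℝ (Fin d)}

/-- The mean deviation in low dimension. -/
theorem eventually_integral_deviationNorm_le (hmeas : ∀ i, Measurable (X i))
    (hindep : iIndepFun X P) (hlaw : ∀ i, P.map (X i) = μ) {p r α γ : ℝ} (hp : 1 ≤ p)
    (hr : 0 < r) (hαr : 1 ≤ α * r)
    (hint : Integrable (fun x => shellWeight p x ^ r) μ)
    (hγ : 1 / 2 ≤ γ) (hγ1 : γ ≤ 1) (hγr : γ * r < 1) (hγp : d * (1 - γ) < p) {ε : ℝ} (hε : 0 < ε) :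
    ∀ᶠ n : ℕ in Filter.atTop, ∀ N : ℕ,
      ∫ ω, deviationNorm μ X (dyadicIndex d N (shellRange p ((n : ℝ) ^ α))) (cellWeight p)
        cellSet n ω ∂P ≤ ε * (n : ℝ) ^ α := by
  obtain ⟨C, hC0, hC⟩ := exists_sum_level_le_of_lt d hγ hγ1 hγp
  have hγ0 : 0 < γ := by linarith
  set b : ℝ := 2 ^ (p * (1 - γ * r)) with hb
  have hb1 : 1 < b := Real.one_lt_rpow (by norm_num) (by
    have : 0 < 1 - γ * r := by linarith
    positivity)
  set G := b / (b - 1) with hG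
  have hG0 : 0 < G := div_pos (by linarith) (by linarith)
  set K : ℝ := 2 * 3 ^ d * (C + 1) with hK
  have hK0 : 0 < K := by positivity
  set a : ℕ → ℝ := fun m => ((2 : ℝ) ^ (r * p * m) * shellMass μ m) ^ γ with ha
  have ha0 : ∀ m, 0 ≤ a m := fun m =>
    Real.rpow_nonneg (mul_nonneg (by positivity) (shellMass_nonneg m)) _
  have hatend : Filter.Tendsto a Filter.atTop (nhds 0) := by
    have := (tendsto_shellMass hint).rpow_const (p := γ) (Or.inr hγ0.le)
    rwa [Real.zero_rpow hγ0.ne'] at this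
  set ε' := ε / (2 * K * G) with hε'
  have hε'0 : 0 < ε' := by positivity
  obtain ⟨m₀, hm₀⟩ := Filter.eventually_atTop.1 (hatend.eventually (gt_mem_nhds hε'0))
  have hγα : γ < α := by
    by_contra! h
    nlinarith
  filter_upwards [eventually_const_mul_rpow_le hγα (K * ∑ m ∈ Finset.range m₀, b ^ m * a m)
    (half_pos hε), Filter.eventually_ge_atTop 1] with n hn hn1 N
  have hn1' : (1 : ℝ) ≤ n := by exact_mod_cast hn1
  have hn0 : (0 : ℝ) < n := by linarith
  have hterm : ∀ m : ℕ, (2 : ℝ) ^ (p * m) * (n * shellMass μ m) ^ γ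
      = (n : ℝ) ^ γ * (b ^ m * a m) := by
    intro m
    rw [Real.mul_rpow hn0.le (shellMass_nonneg m), ha]
    simp only
    rw [Real.mul_rpow (by positivity) (shellMass_nonneg m), ← Real.rpow_mul (by norm_num), hb,
      ← Real.rpow_mul_natCast (by norm_num),
      show p * m = p * (1 - γ * r) * m + r * p * m * γ by ring, Real.rpow_add (by norm_num)]
    ring
  set S := shellRange p ((n : ℝ) ^ α) with hS
  have hgeo : ∑ m ∈ S, b ^ m ≤ ((n : ℝ) ^ α) ^ (1 - γ * r) * G := by
    refine sum_pow_le_of_forall_pow_le hb1 (by positivity) _ fun m hm => ?_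
    have := (mem_shellRange hp).1 hm
    rw [hb, ← Real.rpow_mul_natCast (by norm_num)]
    calc (2 : ℝ) ^ (p * (1 - γ * r) * m) = ((2 : ℝ) ^ (p * m)) ^ (1 - γ * r) := by
          rw [← Real.rpow_mul (by norm_num)]
          ring_nf
      _ ≤ _ := Real.rpow_le_rpow (by positivity) this (by linarith)
  have hsum : ∑ m ∈ S, b ^ m * a m ≤ ∑ m ∈ Finset.range m₀, b ^ m * a m +
      ε' * ∑ m ∈ S, b ^ m := by
    rw [← Finset.sum_filter_add_sum_filter_not S (fun m => m < m₀)]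
    refine add_le_add ?_ ?_
    · refine Finset.sum_le_sum_of_subset_of_nonneg (fun m hm => ?_)
        fun m _ _ => mul_nonneg (by positivity) (ha0 m)
      exact Finset.mem_range.2 (Finset.mem_filter.1 hm).2
    · rw [Finset.mul_sum]
      calc _ ≤ ∑ m ∈ S with ¬ m < m₀, ε' * b ^ m := by
            refine Finset.sum_le_sum fun m hm => ?_
            rw [mul_comm]
            have := (hm₀ m (not_lt.1 (Finset.mem_filter.1 hm).2)).le
            gcongr
        _ ≤ _ := Finset.sum_le_sum_of_subset_of_nonneg (Finset.filter_subset _ _)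
            fun m _ _ => by positivity
  have hexp : (n : ℝ) ^ γ * ((n : ℝ) ^ α) ^ (1 - γ * r) ≤ (n : ℝ) ^ α := by
    rw [← Real.rpow_mul hn0.le, ← Real.rpow_add hn0]
    refine Real.rpow_le_rpow_of_exponent_le hn1' ?_
    nlinarith
  calc _ ≤ _ := integral_deviationNorm_le hmeas hindep hlaw p N S n
    _ ≤ 2 * 3 ^ d * ∑ m ∈ S, 2 ^ (p * m) * ((C + 1) * (n * shellMass μ m) ^ γ) := by
      gcongr with m hm
      have h0 : 0 ≤ n * shellMass μ m := mul_nonneg hn0.le (shellMass_nonneg m)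
      refine (hC N _ h0).trans ?_
      gcongr
      linarith
    _ = K * ((n : ℝ) ^ γ * ∑ m ∈ S, b ^ m * a m) := by
      rw [hK, Finset.mul_sum, Finset.mul_sum, Finset.mul_sum]
      refine Finset.sum_congr rfl fun m _ => ?_
      rw [← hterm m]
      ring
    _ ≤ K * ((n : ℝ) ^ γ * (∑ m ∈ Finset.range m₀, b ^ m * a m +
          ε' * (((n : ℝ) ^ α) ^ (1 - γ * r) * G))) := by
      gcongr
      refine hsum.trans ?_
      gcongr
    _ = K * (∑ m ∈ Finset.range m₀, b ^ m * a m) * (n : ℝ) ^ γ +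
          K * G * ε' * ((n : ℝ) ^ γ * ((n : ℝ) ^ α) ^ (1 - γ * r)) := by ring
    _ ≤ ε / 2 * (n : ℝ) ^ α + K * G * ε' * (n : ℝ) ^ α := by gcongr
    _ = ε * (n : ℝ) ^ α := by
      rw [hε']
      field_simp
      ring

/-- The mean deviation in high dimension. -/
theorem exists_integral_deviationNorm_le (hmeas : ∀ i, Measurable (X i))
    (hindep : iIndepFun X P) (hlaw : ∀ i, P.map (X i) = μ) {p r : ℝ} (hp : 0 < p)
    (hpd : p < d / 2) (hint : Integrable (fun x => shellWeight p x ^ r) μ)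
    (hβr : 1 < (d - p) / d * r) :
    ∃ C : ℝ, 0 ≤ C ∧ ∀ (n N : ℕ) (S : Finset ℕ),
      ∫ ω, deviationNorm μ X (dyadicIndex d N S) (cellWeight p) cellSet n ω ∂P ≤
        C * (n : ℝ) ^ ((d - p) / d) := by
  obtain ⟨C, hC0, hC⟩ := exists_sum_level_le_of_gt hp hpd
  have hd : (0 : ℝ) < d := by linarith
  set β := (d - p) / d with hβ
  have hβ0 : 0 < β := div_pos (by linarith) hd
  set b : ℝ := 2 ^ (p * (β * r - 1)) with hb
  have hb1 : 1 < b := Real.one_lt_rpow (by norm_num) (by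
    have : 0 < β * r - 1 := by linarith
    positivity)
  have hG0 : 0 < b / (b - 1) := div_pos (by linarith) (by linarith)
  obtain ⟨A, hA⟩ := (tendsto_shellMass hint).bddAbove_range
  have hA' : ∀ m : ℕ, (2 : ℝ) ^ (r * p * m) * shellMass μ m ≤ A := fun m => hA ⟨m, rfl⟩
  have hA0 : 0 ≤ A := le_trans (mul_nonneg (by positivity) (shellMass_nonneg 0)) (hA' 0)
  refine ⟨2 * 3 ^ d * (C * (A ^ β * (b / (b - 1)))), by positivity, fun n N S => ?_⟩
  have hn0 : (0 : ℝ) ≤ n := Nat.cast_nonneg n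
  have hterm : ∀ m : ℕ, (2 : ℝ) ^ (p * m) * (n * shellMass μ m) ^ β
      ≤ (n : ℝ) ^ β * (A ^ β * (b ^ m)⁻¹) := by
    intro m
    have h1 : shellMass μ m ≤ A * 2 ^ (-(r * p * m)) := by
      rw [Real.rpow_neg (by norm_num), ← div_eq_mul_inv, le_div_iff₀ (by positivity), mul_comm]
      exact hA' m
    rw [Real.mul_rpow hn0 (shellMass_nonneg m)]
    calc _ ≤ (2 : ℝ) ^ (p * m) * ((n : ℝ) ^ β * (A * 2 ^ (-(r * p * m))) ^ β) := by
          gcongr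
          exact shellMass_nonneg m
      _ = _ := by
          rw [Real.mul_rpow hA0 (by positivity), ← Real.rpow_mul (by norm_num), hb,
            ← Real.rpow_mul_natCast (by norm_num), ← Real.rpow_neg (by norm_num),
            show -(p * (β * r - 1) * m) = p * m + -(r * p * m) * β by ring,
            Real.rpow_add (by norm_num)]
          ring
  calc _ ≤ _ := integral_deviationNorm_le hmeas hindep hlaw p N S n
    _ ≤ 2 * 3 ^ d * ∑ m ∈ S, 2 ^ (p * m) * (C * (n * shellMass μ m) ^ β) := by
      gcongr with m hm
      exact hC N _ (mul_nonneg hn0 (shellMass_nonneg m))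
    _ = 2 * 3 ^ d * (C * ∑ m ∈ S, 2 ^ (p * m) * (n * shellMass μ m) ^ β) := by
      congr 1
      rw [Finset.mul_sum]
      exact Finset.sum_congr rfl fun m _ => by ring
    _ ≤ 2 * 3 ^ d * (C * ∑ m ∈ S, (n : ℝ) ^ β * (A ^ β * (b ^ m)⁻¹)) := by
      exact mul_le_mul_of_nonneg_left (mul_le_mul_of_nonneg_left
        (Finset.sum_le_sum fun m _ => hterm m) hC0) (by positivity)
    _ = 2 * 3 ^ d * (C * ((n : ℝ) ^ β * (A ^ β * ∑ m ∈ S, (b ^ m)⁻¹))) := by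
      simp only [Finset.mul_sum]
    _ ≤ 2 * 3 ^ d * (C * ((n : ℝ) ^ β * (A ^ β * (b / (b - 1))))) := by
      gcongr
      have := sum_inv_pow_le_of_forall_le_pow hb1 one_pos S fun m _ => one_le_pow₀ hb1.le
      simpa using this
    _ = _ := by ring

end mean

/-- Tail sums of the series of `n ^ (-1 - b)`. -/
lemma sum_rpow_neg_le {b z : ℝ} (hb : 0 < b) (hz : 0 < z) (F : Finset ℕ)
    (hF : ∀ n ∈ F, z ≤ (n : ℝ)) :
    ∑ n ∈ F, (n : ℝ) ^ (-1 - b) ≤ (2 + b) / b * z ^ (-b) := by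
  rcases F.eq_empty_or_nonempty with rfl | hne
  · simp only [Finset.sum_empty]
    positivity
  set M := F.max' hne
  set n₀ := F.min' hne
  have hn₀ : z ≤ n₀ := hF _ (F.min'_mem hne)
  have hn₀0 : 0 < n₀ := by exact_mod_cast hz.trans_le hn₀
  have hstep : ∀ n : ℕ, 0 < n → (n : ℝ) ^ (-1 - b) ≤
      (2 + b) / b * ((n : ℝ) ^ (-b) - ((n + 1 : ℕ) : ℝ) ^ (-b)) := by
    intro n hn
    have hn0 : (0 : ℝ) < n := by exact_mod_cast hn
    have hn1 : (1 : ℝ) ≤ n := by exact_mod_cast hn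
    -- comparison of consecutive terms
    have h1 : ((n + 1 : ℕ) : ℝ) ^ (-b) ≤ (n : ℝ) ^ (-b) * (1 + b / (2 * n))⁻¹ := by
      have e : ((n + 1 : ℕ) : ℝ) = n * (1 + 1 / n) := by
        push_cast
        field_simp
      have hlog : 1 / (2 * n : ℝ) ≤ Real.log (1 + 1 / (n : ℝ)) := by
        refine le_trans ?_ (Real.one_sub_inv_le_log_of_pos (by positivity))
        rw [show (1 : ℝ) - (1 + 1 / (n : ℝ))⁻¹ = 1 / (n + 1) by field_simp; ring]
        exact one_div_le_one_div_of_le (by positivity) (by linarith)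
      rw [e, Real.mul_rpow hn0.le (by positivity), Real.rpow_neg (by positivity : 0 ≤ 1 + 1 / (n : ℝ))]
      gcongr
      rw [Real.rpow_def_of_pos (by positivity)]
      have h2 := Real.add_one_le_exp (Real.log (1 + 1 / (n : ℝ)) * b)
      have h3 : b / (2 * n) ≤ Real.log (1 + 1 / (n : ℝ)) * b := by
        calc b / (2 * n) = 1 / (2 * n) * b := by ring
          _ ≤ _ := by gcongr
      linarith
    have h4 : (n : ℝ) ^ (-1 - b) = (n : ℝ) ^ (-b) * (n : ℝ)⁻¹ := by
      rw [← Real.rpow_neg_one, ← Real.rpow_add hn0]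
      ring_nf
    have h5 : (n : ℝ)⁻¹ ≤ (2 + b) / b * (1 - (1 + b / (2 * n))⁻¹) := by
      have e : (1 : ℝ) - (1 + b / (2 * n))⁻¹ = b / (2 * n + b) := by
        have : (2 * n + b : ℝ) ≠ 0 := by positivity
        field_simp
        ring
      rw [e, div_mul_div_comm, mul_comm b, mul_div_mul_right _ _ hb.ne', inv_eq_one_div,
        div_le_div_iff₀ hn0 (by positivity)]
      nlinarith
    have hpos : 0 < (n : ℝ) ^ (-b) := by positivity
    have hcb : 0 ≤ (2 + b) / b := by positivity
    calc (n : ℝ) ^ (-1 - b) ≤ (n : ℝ) ^ (-b) * ((2 + b) / b * (1 - (1 + b / (2 * n))⁻¹)) := by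
          rw [h4]
          gcongr
      _ = (2 + b) / b * ((n : ℝ) ^ (-b) - (n : ℝ) ^ (-b) * (1 + b / (2 * n))⁻¹) := by ring
      _ ≤ _ := by gcongr
  have htel : ∀ m, n₀ ≤ m → ∑ n ∈ Finset.Ico n₀ m, ((n : ℝ) ^ (-b) - ((n + 1 : ℕ) : ℝ) ^ (-b))
      = (n₀ : ℝ) ^ (-b) - (m : ℝ) ^ (-b) := by
    intro m hm
    induction m, hm using Nat.le_induction with
    | base => simp
    | succ m hm ih =>
      rw [Finset.sum_Ico_succ_top hm, ih]
      ring
  have hM : n₀ ≤ M + 1 := (F.min'_le_max' hne).trans (Nat.le_succ _)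
  calc ∑ n ∈ F, (n : ℝ) ^ (-1 - b) ≤ ∑ n ∈ Finset.Ico n₀ (M + 1), (n : ℝ) ^ (-1 - b) := by
        refine Finset.sum_le_sum_of_subset_of_nonneg (fun m hm => ?_) fun _ _ _ => by positivity
        exact Finset.mem_Ico.2 ⟨F.min'_le m hm, Nat.lt_succ_of_le (F.le_max' m hm)⟩
    _ ≤ ∑ n ∈ Finset.Ico n₀ (M + 1),
          (2 + b) / b * ((n : ℝ) ^ (-b) - ((n + 1 : ℕ) : ℝ) ^ (-b)) :=
        Finset.sum_le_sum fun n hn => hstep n (hn₀0.trans_le (Finset.mem_Ico.1 hn).1)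
    _ = (2 + b) / b * ((n₀ : ℝ) ^ (-b) - ((M + 1 : ℕ) : ℝ) ^ (-b)) := by
        rw [← Finset.mul_sum, htel _ hM]
    _ ≤ (2 + b) / b * z ^ (-b) := by
        gcongr
        have h1 : (0 : ℝ) ≤ ((M + 1 : ℕ) : ℝ) ^ (-b) := by positivity
        have h2 : (n₀ : ℝ) ^ (-b) ≤ z ^ (-b) :=
          Real.rpow_le_rpow_of_nonpos hz hn₀ (by linarith)
        linarith

lemma le_rpow_natCast_iff {α y : ℝ} (hα : 0 < α) (hy : 0 < y) (n : ℕ) :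
    y ≤ (n : ℝ) ^ α ↔ y ^ (1 / α) ≤ n := by
  rw [one_div, Real.rpow_inv_le_iff_of_pos hy.le (Nat.cast_nonneg n) hα]

/-- The series of the large values. -/
lemma tsum_rpow_mul_measure_lt_le {d : ℕ} {p r α : ℝ} (hα : 0 < α) (hαr : 1 ≤ α * r)
    (μ : Measure (EuclideanSpace ℝ (Fin d))) :
    ∑' n : ℕ+, ENNReal.ofReal ((n : ℝ) ^ (α * r - 1)) * μ {x | (n : ℝ) ^ α < shellWeight p x} ≤
      ∫⁻ x, ENNReal.ofReal (shellWeight p x ^ r) ∂μ := by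
  have hms : ∀ n : ℕ+, MeasurableSet {x : EuclideanSpace ℝ (Fin d) |
      (n : ℝ) ^ α < shellWeight p x} := fun n =>
    measurableSet_lt measurable_const (measurable_shellWeight p)
  calc _ = ∑' n : ℕ+, ∫⁻ x, {x | (n : ℝ) ^ α < shellWeight p x}.indicator
        (fun _ => ENNReal.ofReal ((n : ℝ) ^ (α * r - 1))) x ∂μ := by
        refine tsum_congr fun n => ?_
        rw [lintegral_indicator_const (hms n)]
    _ = ∫⁻ x, ∑' n : ℕ+, {x | (n : ℝ) ^ α < shellWeight p x}.indicator
        (fun _ => ENNReal.ofReal ((n : ℝ) ^ (α * r - 1))) x ∂μ := by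
        rw [lintegral_tsum fun n => (measurable_const.indicator (hms n)).aemeasurable]
    _ ≤ _ := by
        refine lintegral_mono fun x => ?_
        rw [ENNReal.tsum_eq_iSup_sum]
        refine iSup_le fun s => ?_
        set y := shellWeight p x with hy
        have hy0 : 0 < y := shellWeight_pos p x
        set z := y ^ (1 / α) with hz
        have hz0 : 0 < z := by positivity
        have hlt : ∀ n : ℕ, (n : ℝ) ^ α < y ↔ (n : ℝ) < z := fun n => by
          rw [← not_le, le_rpow_natCast_iff hα hy0, not_le]
        have h1 : ∀ n : ℕ+, {x | (n : ℝ) ^ α < shellWeight p x}.indicator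
            (fun _ => ENNReal.ofReal ((n : ℝ) ^ (α * r - 1))) x =
            if (n : ℝ) < z then ENNReal.ofReal ((n : ℝ) ^ (α * r - 1)) else 0 := by
          intro n
          simp only [Set.indicator, Set.mem_ofPred_eq, ← hy, hlt]
        simp only [h1]
        rw [← Finset.sum_filter]
        have hcard : (((s.filter fun n : ℕ+ => (n : ℝ) < z).card : ℕ) : ℝ) ≤ z := by
          have : (s.filter fun n : ℕ+ => (n : ℝ) < z).card ≤ ⌊z⌋₊ := by
            rw [← Nat.add_sub_cancel ⌊z⌋₊ 1, ← Nat.card_Icc]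
            refine Finset.card_le_card_of_injOn (fun n : ℕ+ => (n : ℕ)) (fun n hn => ?_)
              PNat.coe_injective.injOn
            have := (Finset.mem_filter.1 hn).2
            exact Finset.mem_coe.2 (Finset.mem_Icc.2 ⟨n.pos, Nat.le_floor this.le⟩)
          exact (Nat.cast_le.2 this).trans (Nat.floor_le hz0.le)
        calc _ ≤ ∑ n ∈ s with ((n : ℕ+) : ℝ) < z, ENNReal.ofReal (z ^ (α * r - 1)) := by
              refine Finset.sum_le_sum fun n hn => ENNReal.ofReal_le_ofReal ?_
              exact Real.rpow_le_rpow (by positivity) (Finset.mem_filter.1 hn).2.le (by linarith)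
          _ = ENNReal.ofReal ((s.filter fun n : ℕ+ => (n : ℝ) < z).card * z ^ (α * r - 1)) := by
              rw [Finset.sum_const, nsmul_eq_mul, ENNReal.ofReal_mul (by positivity),
                ENNReal.ofReal_natCast]
          _ ≤ _ := by
              refine ENNReal.ofReal_le_ofReal ?_
              calc _ ≤ z * z ^ (α * r - 1) := by gcongr
                _ = z ^ (α * r) := by
                  conv_lhs => rw [← Real.rpow_one z]
                  rw [← Real.rpow_mul hz0.le, ← Real.rpow_add hz0]
                  ring_nf
                _ = y ^ r := by
                  rw [hz, ← Real.rpow_mul hy0.le]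
                  congr 1
                  field_simp

/-- The series of the truncated second moments. -/
lemma tsum_rpow_mul_setLIntegral_sq_le {d : ℕ} {p r α : ℝ} (hα : 0 < α) (hr : r < 2)
    (μ : Measure (EuclideanSpace ℝ (Fin d))) :
    ∑' n : ℕ+, ENNReal.ofReal ((n : ℝ) ^ (α * r - 1 - 2 * α)) *
        ∫⁻ x in {x | shellWeight p x ≤ (n : ℝ) ^ α}, ENNReal.ofReal (shellWeight p x ^ 2) ∂μ ≤
      ENNReal.ofReal ((2 + α * (2 - r)) / (α * (2 - r))) *
        ∫⁻ x, ENNReal.ofReal (shellWeight p x ^ r) ∂μ := by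
  set b := α * (2 - r) with hb
  have hb0 : 0 < b := mul_pos hα (by linarith)
  have hC : 0 ≤ (2 + b) / b := by positivity
  have hms : ∀ n : ℕ+, MeasurableSet {x : EuclideanSpace ℝ (Fin d) |
      shellWeight p x ≤ (n : ℝ) ^ α} := fun n =>
    measurableSet_le (measurable_shellWeight p) measurable_const
  have hD2 : Measurable fun x : EuclideanSpace ℝ (Fin d) => ENNReal.ofReal (shellWeight p x ^ 2) :=
    ((measurable_shellWeight p).pow_const 2).ennreal_ofReal
  have hDr : Measurable fun x : EuclideanSpace ℝ (Fin d) => ENNReal.ofReal (shellWeight p x ^ r) :=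
    ((measurable_shellWeight p).pow_const r).ennreal_ofReal
  calc _ = ∑' n : ℕ+, ∫⁻ x, ENNReal.ofReal ((n : ℝ) ^ (α * r - 1 - 2 * α)) *
        {x | shellWeight p x ≤ (n : ℝ) ^ α}.indicator
        (fun x => ENNReal.ofReal (shellWeight p x ^ 2)) x ∂μ := by
        refine tsum_congr fun n => ?_
        rw [lintegral_const_mul _ (hD2.indicator (hms n)), lintegral_indicator (hms n)]
    _ = ∫⁻ x, ∑' n : ℕ+, ENNReal.ofReal ((n : ℝ) ^ (α * r - 1 - 2 * α)) *
        {x | shellWeight p x ≤ (n : ℝ) ^ α}.indicator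
        (fun x => ENNReal.ofReal (shellWeight p x ^ 2)) x ∂μ := by
        rw [lintegral_tsum fun n => ((hD2.indicator (hms n)).const_mul _).aemeasurable]
    _ ≤ ∫⁻ x, ENNReal.ofReal ((2 + b) / b) * ENNReal.ofReal (shellWeight p x ^ r) ∂μ := by
        refine lintegral_mono fun x => ?_
        rw [ENNReal.tsum_eq_iSup_sum]
        refine iSup_le fun s => ?_
        set y := shellWeight p x with hy
        have hy0 : 0 < y := shellWeight_pos p x
        set z := y ^ (1 / α) with hz
        have hz0 : 0 < z := by positivity
        have h1 : ∀ n : ℕ+, ENNReal.ofReal ((n : ℝ) ^ (α * r - 1 - 2 * α)) *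
            {x | shellWeight p x ≤ (n : ℝ) ^ α}.indicator
            (fun x => ENNReal.ofReal (shellWeight p x ^ 2)) x =
            if z ≤ (n : ℝ) then ENNReal.ofReal ((n : ℝ) ^ (-1 - b) * y ^ 2) else 0 := by
          intro n
          have e : α * r - 1 - 2 * α = -1 - b := by rw [hb]; ring
          simp only [Set.indicator, Set.mem_ofPred_eq, ← hy, le_rpow_natCast_iff hα hy0, ← hz, e]
          split_ifs
          · rw [ENNReal.ofReal_mul (by positivity)]
          · simp
        simp only [h1]
        rw [← Finset.sum_filter, ← ENNReal.ofReal_sum_of_nonneg (fun n _ => by positivity),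
          ← ENNReal.ofReal_mul hC]
        refine ENNReal.ofReal_le_ofReal ?_
        rw [← Finset.sum_mul]
        have h2 := sum_rpow_neg_le hb0 hz0
          ((s.filter fun n : ℕ+ => z ≤ (n : ℝ)).map ⟨fun n : ℕ+ => (n : ℕ), PNat.coe_injective⟩)
          (by
            intro n hn
            obtain ⟨m, hm, rfl⟩ := Finset.mem_map.1 hn
            exact (Finset.mem_filter.1 hm).2)
        rw [Finset.sum_map] at h2
        simp only [Function.Embedding.coeFn_mk] at h2
        calc _ ≤ (2 + b) / b * z ^ (-b) * y ^ 2 := by gcongr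
          _ = (2 + b) / b * y ^ r := by
            rw [mul_assoc]
            congr 1
            rw [hz, ← Real.rpow_mul hy0.le, ← Real.rpow_natCast, ← Real.rpow_add hy0]
            congr 1
            rw [hb]
            field_simp
            push_cast
            ring
    _ = _ := lintegral_const_mul _ hDr

section deviation

variable {d : ℕ} {Ω : Type*} [MeasurableSpace Ω]
  {P : Measure Ω} [IsProbabilityMeasure P] {μ : Measure (EuclideanSpace ℝ (Fin d))}
  [IsProbabilityMeasure μ] {X : ℕ → Ω → EuclideanSpace ℝ (Fin d)}

lemma sum_cellWeight_mul_indicator_le {p : ℝ} (hp : 1 ≤ p) (N : ℕ) (T : ℝ)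
    (x : EuclideanSpace ℝ (Fin d)) :
    ∑ j ∈ dyadicIndex d N (shellRange p T), cellWeight p j * (cellSet j).indicator 1 x ≤
      2 * {x | shellWeight p x ≤ T}.indicator (shellWeight p) x := by
  classical
  have h1 : ∀ l : ℕ, ∑ c ∈ shellRange p T ×ˢ dyadicBox d l,
      cellWeight p ⟨l, c⟩ * (cellSet (⟨l, c⟩ : Σ _ : ℕ, ℕ × (Fin d → ℤ))).indicator 1 x ≤
      2 ^ (-(p * l)) * {x | shellWeight p x ≤ T}.indicator (shellWeight p) x := by
    intro l
    have e : ∀ c : ℕ × (Fin d → ℤ),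
        cellWeight p ⟨l, c⟩ * (cellSet (⟨l, c⟩ : Σ _ : ℕ, ℕ × (Fin d → ℤ))).indicator 1 x =
        if dyadicCell l x = c then 2 ^ (-(p * l)) * shellWeight p x else 0 := by
      intro c
      simp only [cellSet, Set.indicator, Set.mem_preimage, Set.mem_singleton_iff]
      split_ifs with h
      · subst h
        simp [cellWeight, shellWeight, dyadicCell]
      · simp
    simp only [e]
    rw [Finset.sum_ite_eq]
    split_ifs with h
    · have hT : shellWeight p x ≤ T :=
        (mem_shellRange hp).1 (Finset.mem_product.1 h).1
      rw [Set.indicator_of_mem (by exact hT)]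
    · exact mul_nonneg (by positivity)
        (Set.indicator_nonneg (fun x _ => (shellWeight_pos p x).le) x)
  rw [dyadicIndex, Finset.sum_sigma]
  calc _ ≤ ∑ l ∈ Finset.range N,
        2 ^ (-(p * l)) * {x | shellWeight p x ≤ T}.indicator (shellWeight p) x :=
        Finset.sum_le_sum fun l _ => h1 l
    _ = (∑ l ∈ Finset.range N, (2 : ℝ) ^ (-(p * l))) *
        {x | shellWeight p x ≤ T}.indicator (shellWeight p) x := by rw [Finset.sum_mul]
    _ ≤ _ := by
        refine mul_le_mul_of_nonneg_right (sum_range_two_rpow_neg_le hp N)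
          (Set.indicator_nonneg (fun x _ => (shellWeight_pos p x).le) x)

/-- The deviation inequality for the truncated part. -/
theorem measure_exists_le_deviationNorm_le_sq (hmeas : ∀ i, Measurable (X i))
    (hindep : iIndepFun X P) (hlaw : ∀ i, P.map (X i) = μ) {p : ℝ} (hp : 1 ≤ p) (N : ℕ) {T : ℝ}
    (hT : 0 ≤ T) {n : ℕ} (hn : 1 ≤ n) {ε M : ℝ}
    (hM : ∫ ω, deviationNorm μ X (dyadicIndex d N (shellRange p T)) (cellWeight p) cellSet n ω ∂P
      ≤ M) (hε : M < ε) :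
    P {ω | ∃ k, 1 ≤ k ∧ k ≤ n ∧
        ε ≤ deviationNorm μ X (dyadicIndex d N (shellRange p T)) (cellWeight p) cellSet k ω} ≤
      ENNReal.ofReal (16 * n / (ε - M) ^ 2) *
        ∫⁻ x in {x | shellWeight p x ≤ T}, ENNReal.ofReal (shellWeight p x ^ 2) ∂μ := by
  set J := dyadicIndex d N (shellRange p T) with hJ
  have hms : MeasurableSet {x : EuclideanSpace ℝ (Fin d) | shellWeight p x ≤ T} :=
    measurableSet_le (measurable_shellWeight p) measurable_const
  set g : EuclideanSpace ℝ (Fin d) → ℝ := {x | shellWeight p x ≤ T}.indicator (shellWeight p)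
    with hg
  have hgm : Measurable g := (measurable_shellWeight p).indicator hms
  have hg0 : ∀ x, 0 ≤ g x := Set.indicator_nonneg fun x _ => (shellWeight_pos p x).le
  have hgT : ∀ x, |g x| ≤ T := by
    intro x
    rw [abs_of_nonneg (hg0 x)]
    by_cases hx : x ∈ {x : EuclideanSpace ℝ (Fin d) | shellWeight p x ≤ T}
    · rw [hg, Set.indicator_of_mem hx]
      exact hx
    · rw [hg, Set.indicator_of_notMem hx]
      exact hT
  have hgint : Integrable g μ := integrable_of_abs_le hgm hgT
  have hgL : MemLp g 2 μ := memLp_two_of_abs_le hgm hgT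
  have hg2 : Integrable (fun x => g x ^ 2) μ := hgL.integrable_sq
  set e := ∫ x, g x ∂μ with he
  have he0 : 0 ≤ e := integral_nonneg hg0
  have hind : ∀ j, Integrable ((cellSet j).indicator (1 : EuclideanSpace ℝ (Fin d) → ℝ)) μ :=
    fun j => (integrable_const (1 : ℝ)).indicator (measurableSet_cellSet j)
  have hmean : ∑ j ∈ J, cellWeight p j * μ.real (cellSet j) ≤ 2 * e := by
    calc _ = ∫ x, ∑ j ∈ J, cellWeight p j * (cellSet j).indicator 1 x ∂μ := by
          rw [integral_finsetSum _ fun j _ => (hind j).const_mul _]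
          simp only [integral_const_mul, integral_indicator_one (measurableSet_cellSet _)]
      _ ≤ ∫ x, 2 * g x ∂μ := by
          refine integral_mono (integrable_finsetSum _ fun j _ => (hind j).const_mul _)
            (hgint.const_mul 2) fun x => sum_cellWeight_mul_indicator_le hp N T x
      _ = 2 * e := integral_const_mul _ _
  have hc : ∀ x, ∑ j ∈ J, cellWeight p j * |(cellSet j).indicator 1 x - μ.real (cellSet j)| ≤
      2 * g x + 2 * e := by
    intro x
    refine le_trans ?_ (add_le_add (sum_cellWeight_mul_indicator_le hp N T x) hmean)
    rw [← Finset.sum_add_distrib]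
    refine Finset.sum_le_sum fun j _ => ?_
    rw [← mul_add]
    refine mul_le_mul_of_nonneg_left ((abs_sub _ _).trans (le_of_eq ?_)) (cellWeight_nonneg p j)
    rw [abs_of_nonneg (Set.indicator_nonneg (f := (1 : EuclideanSpace ℝ (Fin d) → ℝ))
      (fun _ _ => zero_le_one) x), abs_of_nonneg measureReal_nonneg]
  have hcsq : ∀ x, (2 * g x + 2 * e) ^ 2 = 4 * g x ^ 2 + (8 * e * g x + 4 * e ^ 2) := fun x => by
    ring
  have hcint : Integrable (fun x => (2 * g x + 2 * e) ^ 2) μ := by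
    simp only [hcsq]
    exact (hg2.const_mul 4).add ((hgint.const_mul _).add (integrable_const _))
  have hcle : ∫ x, (2 * g x + 2 * e) ^ 2 ∂μ ≤ 16 * ∫ x, g x ^ 2 ∂μ := by
    have h1 : ∫ x, (2 * g x + 2 * e) ^ 2 ∂μ = 4 * ∫ x, g x ^ 2 ∂μ + (8 * e * e + 4 * e ^ 2) := by
      simp only [hcsq]
      have hi : Integrable (fun x => 8 * e * g x + 4 * e ^ 2) μ :=
        (hgint.const_mul _).add (integrable_const _)
      rw [integral_add (hg2.const_mul 4) hi,
        integral_add (hgint.const_mul _) (integrable_const _), integral_const_mul,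
        integral_const_mul]
      simp [← he]
    have h2 := variance_nonneg g μ
    rw [variance_eq_sub hgL] at h2
    simp only [Pi.pow_apply, ← he] at h2
    rw [h1]
    nlinarith
  have hG : ENNReal.ofReal (∫ x, g x ^ 2 ∂μ) =
      ∫⁻ x in {x | shellWeight p x ≤ T}, ENNReal.ofReal (shellWeight p x ^ 2) ∂μ := by
    rw [ofReal_integral_eq_lintegral_ofReal hg2 (ae_of_all _ fun x => sq_nonneg _),
      ← lintegral_indicator hms]
    refine lintegral_congr fun x => ?_
    by_cases hx : x ∈ {x : EuclideanSpace ℝ (Fin d) | shellWeight p x ≤ T}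
    · rw [hg, Set.indicator_of_mem hx, Set.indicator_of_mem hx]
    · rw [hg, Set.indicator_of_notMem hx, Set.indicator_of_notMem hx]
      simp
  refine (measure_exists_le_deviationNorm_le (fun i => (hmeas i).stronglyMeasurable) hindep hlaw J
    (fun j _ => cellWeight_nonneg p j) measurableSet_cellSet hc hcint hn hM hε).trans ?_
  rw [← hG, ← ENNReal.ofReal_mul (by positivity)]
  refine ENNReal.ofReal_le_ofReal ?_
  calc _ ≤ n * (16 * ∫ x, g x ^ 2 ∂μ) / (ε - M) ^ 2 := by gcongr
    _ = _ := by ring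

/-- The deviation inequality for a fixed sample size. -/
theorem measure_lt_maxWassersteinPow_le (hmeas : ∀ i, Measurable (X i))
    (hindep : iIndepFun X P) (hlaw : ∀ i, P.map (X i) = μ) (hd : 1 ≤ d) {p : ℝ} (hp : 1 ≤ p)
    (hint : Integrable (shellWeight p) μ) {n : ℕ} (hn : 1 ≤ n) {T τ : ℝ} (hT : 0 ≤ T) (hτ : 0 < τ)
    (hout : (4 * d) ^ p * (2 * (n * ∫ x in {x | T < shellWeight p x}, shellWeight p x ∂μ)) ≤ τ / 8)
    (hmean : ∀ N : ℕ, (4 * d) ^ p *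
      ∫ ω, deviationNorm μ X (dyadicIndex d N (shellRange p T)) (cellWeight p) cellSet n ω ∂P
        ≤ τ / 8) :
    P {ω | ENNReal.ofReal τ < maxWassersteinPow p μ X n ω} ≤
      n * μ {x | T < shellWeight p x} + ENNReal.ofReal (64 * ((4 * d) ^ p) ^ 2 * n / τ ^ 2) *
        ∫⁻ x in {x | shellWeight p x ≤ T}, ENNReal.ofReal (shellWeight p x ^ 2) ∂μ := by
  have hd0 : (0 : ℝ) < d := by exact_mod_cast hd
  set K : ℝ := (4 * d) ^ p with hK
  have hK0 : 0 < K := by positivity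
  have hED : 0 ≤ ∫ x, shellWeight p x ∂μ := integral_nonneg fun x => (shellWeight_pos p x).le
  obtain ⟨N, hN⟩ : ∃ N : ℕ, K * (2 ^ (-(p * N)) * (n * (T + ∫ x, shellWeight p x ∂μ))) ≤ τ / 8 := by
    set B := K * (n * (T + ∫ x, shellWeight p x ∂μ)) with hB
    have hB0 : 0 ≤ B := by positivity
    obtain ⟨N, hN⟩ := exists_pow_lt_of_lt_one (show (0 : ℝ) < τ / 8 / (B + 1) by positivity)
      (show (1 / 2 : ℝ) < 1 by norm_num)
    refine ⟨N, ?_⟩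
    have h1 : (2 : ℝ) ^ (-(p * N)) ≤ (1 / 2) ^ N := by
      rw [one_div, inv_pow, ← Real.rpow_natCast, ← Real.rpow_neg (by norm_num)]
      refine Real.rpow_le_rpow_of_exponent_le (by norm_num) ?_
      nlinarith [Nat.cast_nonneg (α := ℝ) N]
    rw [lt_div_iff₀ (by positivity)] at hN
    have h2 : (0 : ℝ) ≤ (1 / 2) ^ N := by positivity
    calc _ = 2 ^ (-(p * N)) * B := by rw [hB]; ring
      _ ≤ (1 / 2) ^ N * B := by gcongr
      _ ≤ τ / 8 := by nlinarith
  set f : ℕ → Ω → ℝ :=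
    deviationNorm μ X (dyadicIndex d N (shellRange p T)) (cellWeight p) cellSet with hf
  have hM : ∫ ω, f n ω ∂P ≤ τ / (8 * K) := by
    have := hmean N
    rw [le_div_iff₀ (by positivity)]
    linarith
  have hms : MeasurableSet {x : EuclideanSpace ℝ (Fin d) | T < shellWeight p x} :=
    measurableSet_lt measurable_const (measurable_shellWeight p)
  have hsub : {ω | ENNReal.ofReal τ < maxWassersteinPow p μ X n ω} ⊆
      (⋃ i ∈ Finset.range n, X i ⁻¹' {x | T < shellWeight p x}) ∪
        {ω | ∃ k, 1 ≤ k ∧ k ≤ n ∧ 3 * τ / (4 * K) ≤ f k ω} := by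
    intro ω hω
    by_cases hbig : ∃ i < n, T < shellWeight p (X i ω)
    · left
      obtain ⟨i, hi, h⟩ := hbig
      exact Set.mem_biUnion (Finset.mem_coe.2 (Finset.mem_range.2 hi)) h
    · right
      push Not at hbig
      simp only [Set.mem_ofPred_eq, maxWassersteinPow, Finset.lt_sup_iff, Finset.mem_Icc] at hω
      obtain ⟨k, ⟨hk1, hkn⟩, hk⟩ := hω
      refine ⟨k, hk1, hkn, ?_⟩
      have h1 := mul_wassersteinPow_empiricalMeasure_le hp μ hint X N (shellRange p T) hT hk1 hkn ω
        (fun i hi => ⟨(mem_shellRange hp).2 (hbig i hi), hbig i hi⟩)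
      rw [setOf_dyadicShell_notMem_shellRange hp] at h1
      have h2 := (ENNReal.ofReal_lt_ofReal_iff_of_nonneg hτ.le).1 (hk.trans_le h1)
      rw [mul_add, mul_add] at h2
      rw [div_le_iff₀ (by positivity)]
      change τ < _ + _ + K * f k ω at h2
      linarith
  refine (measure_mono hsub).trans ((measure_union_le _ _).trans (add_le_add ?_ ?_))
  · calc _ ≤ ∑ i ∈ Finset.range n, P (X i ⁻¹' {x | T < shellWeight p x}) :=
          measure_biUnion_finset_le _ _
      _ = ∑ i ∈ Finset.range n, μ {x | T < shellWeight p x} :=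
          Finset.sum_congr rfl fun i _ => by rw [← Measure.map_apply (hmeas i) hms, hlaw]
      _ = _ := by simp
  · have hlt : τ / (8 * K) < 3 * τ / (4 * K) := by
      rw [div_lt_div_iff₀ (by positivity) (by positivity)]
      nlinarith [mul_pos hτ hK0]
    refine (measure_exists_le_deviationNorm_le_sq hmeas hindep hlaw hp N hT hn hM hlt).trans ?_
    refine mul_le_mul_left (ENNReal.ofReal_le_ofReal ?_) _
    have e : 3 * τ / (4 * K) - τ / (8 * K) = 5 * τ / (8 * K) := by
      field_simp
      ring
    rw [e, div_pow, div_div_eq_mul_div, div_le_div_iff₀ (by positivity) (by positivity)]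
    have : (0 : ℝ) ≤ n * K ^ 2 * τ ^ 2 := by positivity
    nlinarith

end deviation

/-- A theorem of Baum-Katz type: the deviation probabilities at thresholds of order at least
`n ^ α` which dominate the mean deviations are summable with the weights `n ^ (α r - 2)`. -/
theorem tsum_rpow_mul_measure_lt_maxWassersteinPow_lt_top {d : ℕ} {Ω : Type*} [MeasurableSpace Ω]
    {P : Measure Ω} [IsProbabilityMeasure P] {μ : Measure (EuclideanSpace ℝ (Fin d))}
    [IsProbabilityMeasure μ] {X : ℕ → Ω → EuclideanSpace ℝ (Fin d)}
    (hmeas : ∀ i, Measurable (X i)) (hindep : iIndepFun X P) (hlaw : ∀ i, P.map (X i) = μ)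
    (hd : 1 ≤ d) {p r α c : ℝ} (hp : 1 ≤ p) (hr₁ : 1 ≤ r) (hr₂ : r < 2) (hα : 0 < α)
    (hαr : 1 ≤ α * r) (hc : 0 < c) (hint : Integrable (fun x => shellWeight p x ^ r) μ) {t : ℕ → ℝ}
    (ht : ∀ᶠ n : ℕ in Filter.atTop, c * (n : ℝ) ^ α ≤ t n)
    (hmean : ∀ᶠ n : ℕ in Filter.atTop, ∀ N : ℕ, (4 * d) ^ p *
      ∫ ω, deviationNorm μ X (dyadicIndex d N (shellRange p ((n : ℝ) ^ α))) (cellWeight p)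
        cellSet n ω ∂P ≤ t n / 8) :
    ∑' n : ℕ+, ENNReal.ofReal ((n : ℝ) ^ (α * r - 2)) *
        P {ω | ENNReal.ofReal (t n) < maxWassersteinPow p μ X n ω} < ∞ := by
  have hd0 : (0 : ℝ) < d := by exact_mod_cast hd
  set K : ℝ := (4 * d) ^ p with hK
  have hK0 : 0 < K := by positivity
  obtain ⟨n₀, hn₀⟩ := Filter.eventually_atTop.1 (ht.and (hmean.and
    (eventually_mul_setIntegral_shellWeight_le hp hr₁ hα hαr hint
      (show 0 < c / (16 * K) by positivity))))
  have hterm : ∀ n : ℕ+, ENNReal.ofReal ((n : ℝ) ^ (α * r - 2)) *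
        P {ω | ENNReal.ofReal (t n) < maxWassersteinPow p μ X n ω} ≤
      (if (n : ℕ) < n₀ then ENNReal.ofReal ((n : ℝ) ^ (α * r - 2)) else 0) +
      ENNReal.ofReal ((n : ℝ) ^ (α * r - 1)) * μ {x | (n : ℝ) ^ α < shellWeight p x} +
      ENNReal.ofReal (64 * K ^ 2 / c ^ 2) * (ENNReal.ofReal ((n : ℝ) ^ (α * r - 1 - 2 * α)) *
        ∫⁻ x in {x | shellWeight p x ≤ (n : ℝ) ^ α}, ENNReal.ofReal (shellWeight p x ^ 2) ∂μ) := by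
    intro n
    by_cases hn : (n : ℕ) < n₀
    · rw [if_pos hn, add_assoc]
      exact le_trans (mul_le_of_le_one_right zero_le prob_le_one) (le_add_right le_rfl)
    rw [if_neg hn, zero_add]
    obtain ⟨h1, h2, h3⟩ := hn₀ n (not_lt.1 hn)
    have hn0 : (0 : ℝ) < n := by exact_mod_cast n.pos
    have hnα : (0 : ℝ) < (n : ℝ) ^ α := by positivity
    have hτ : 0 < t n := lt_of_lt_of_le (by positivity) h1
    have hout : K * (2 * ((n : ℝ) *
        ∫ x in {x | (n : ℝ) ^ α < shellWeight p x}, shellWeight p x ∂μ)) ≤ t n / 8 := by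
      calc _ ≤ K * (2 * (c / (16 * K) * (n : ℝ) ^ α)) := by gcongr
        _ = c * (n : ℝ) ^ α / 8 := by
          field_simp
          ring
        _ ≤ _ := by gcongr
    have hmain := measure_lt_maxWassersteinPow_le hmeas hindep hlaw hd hp
      (integrable_shellWeight (by linarith) hr₁ hint) n.pos hnα.le hτ hout h2
    refine (mul_le_mul_right hmain _).trans ?_
    rw [mul_add, ← mul_assoc, ← mul_assoc, ← mul_assoc]
    refine add_le_add (mul_le_mul_left (le_of_eq ?_) _) (mul_le_mul_left ?_ _)
    · have e : (n : ℝ) ^ (α * r - 2) * n = (n : ℝ) ^ (α * r - 1) := by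
        rw [← Real.rpow_add_one hn0.ne']
        congr 1
        ring
      rw [← ENNReal.ofReal_natCast, ← ENNReal.ofReal_mul (by positivity)]
      exact congrArg ENNReal.ofReal e
    · rw [← ENNReal.ofReal_mul (by positivity), ← ENNReal.ofReal_mul (by positivity)]
      refine ENNReal.ofReal_le_ofReal ?_
      have e : (n : ℝ) ^ (α * r - 1 - 2 * α) =
          (n : ℝ) ^ (α * r - 2) * n / ((n : ℝ) ^ α) ^ 2 := by
        rw [← Real.rpow_add_one hn0.ne', ← Real.rpow_natCast, ← Real.rpow_mul hn0.le,
          ← Real.rpow_sub hn0]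
        congr 1
        push_cast
        ring
      rw [e]
      calc (n : ℝ) ^ (α * r - 2) * (64 * K ^ 2 * n / t n ^ 2)
          ≤ (n : ℝ) ^ (α * r - 2) * (64 * K ^ 2 * n / (c * (n : ℝ) ^ α) ^ 2) := by gcongr
        _ = _ := by
          rw [mul_pow]
          field_simp
  have hfin : ∫⁻ x, ENNReal.ofReal (shellWeight p x ^ r) ∂μ < ∞ := by
    rw [← ofReal_integral_eq_lintegral_ofReal hint
      (ae_of_all _ fun x => Real.rpow_nonneg (shellWeight_pos p x).le r)]
    exact ENNReal.ofReal_lt_top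
  refine (ENNReal.tsum_le_tsum hterm).trans_lt ?_
  rw [ENNReal.tsum_add, ENNReal.tsum_add, ENNReal.tsum_mul_left]
  refine ENNReal.add_lt_top.2 ⟨ENNReal.add_lt_top.2 ⟨?_, ?_⟩, ENNReal.mul_lt_top
    ENNReal.ofReal_lt_top ?_⟩
  · refine (ENNReal.tsum_comp_le_tsum_of_injective PNat.coe_injective (fun n : ℕ =>
      if n < n₀ then ENNReal.ofReal ((n : ℝ) ^ (α * r - 2)) else 0)).trans_lt ?_
    rw [tsum_eq_sum (s := Finset.range n₀) (fun n hn => if_neg (by simpa using hn))]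
    refine ENNReal.sum_lt_top.2 fun n _ => ?_
    split_ifs <;> simp
  · exact (tsum_rpow_mul_measure_lt_le hα hαr μ).trans_lt hfin
  · exact (tsum_rpow_mul_setLIntegral_sq_le hα hr₂ μ).trans_lt
      (ENNReal.mul_lt_top ENNReal.ofReal_lt_top hfin)

theorem theorem3p3 {d : ℕ} (hd : 1 ≤ d) {Ω : Type*} [MeasurableSpace Ω]
    (P : Measure Ω) [IsProbabilityMeasure P]
    (μ : Measure (EuclideanSpace ℝ (Fin d))) (X : ℕ → Ω → EuclideanSpace ℝ (Fin d))
    (hmeas : ∀ i, Measurable (X i)) (hindep : iIndepFun X P) (hlaw : ∀ i, P.map (X i) = μ)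
    (p r x : ℝ) (hp : 1 ≤ p) (hr₁ : 1 < r) (hr₂ : r < 2) (hx : 0 < x)
    (hmom : strongMoment (r * p) μ < ∞) :
    (d * (r - 1) / r < p → ∀ α : ℝ, 1 / r ≤ α → α ≤ 1 →
      ∑' n : ℕ+, ENNReal.ofReal ((n : ℝ) ^ (α * r - 2)) *
        P {ω | ENNReal.ofReal ((n : ℝ) ^ α * x) < maxWassersteinPow p μ X n ω} < ∞) ∧
    (p < d * (r - 1) / r → ∀ α : ℝ, (d - p) / d < α → α ≤ 1 →
      ∑' n : ℕ+, ENNReal.ofReal ((n : ℝ) ^ ((p * r - (1 - α) * r * d - d) / d)) *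
        P {ω | ENNReal.ofReal ((n : ℝ) ^ α * x) < maxWassersteinPow p μ X n ω} < ∞) ∧
    (p < d * (r - 1) / r →
      ∑' n : ℕ+, ENNReal.ofReal (1 / (n : ℝ)) *
        P {ω | ENNReal.ofReal ((n : ℝ) ^ ((d - p) / d) * Real.log n ^ (1 / r) * x)
          < maxWassersteinPow p μ X n ω} < ∞) := by
  have hμ : IsProbabilityMeasure μ := by
    rw [← hlaw 0]
    exact Measure.isProbabilityMeasure_map (hmeas 0).aemeasurable
  have hd0 : (0 : ℝ) < d := by exact_mod_cast hd
  have hr0 : 0 < r := by linarith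
  have hint : Integrable (fun y => shellWeight p y ^ r) μ :=
    integrable_shellWeight_rpow (by positivity) hmom
  have hK0 : (0 : ℝ) < (4 * d) ^ p := by positivity
  set K : ℝ := (4 * d) ^ p with hK
  have hlow : p < d * (r - 1) / r → p < d / 2 ∧ 1 < (d - p) / d * r := by
    intro h
    rw [lt_div_iff₀ hr0] at h
    constructor
    · nlinarith
    · rw [div_mul_eq_mul_div, lt_div_iff₀ hd0]
      linarith
  refine ⟨fun h α hα₁ hα₂ => ?_, fun h α hα₁ hα₂ => ?_, fun h => ?_⟩
  · have hα0 : 0 < α := lt_of_lt_of_le (by positivity) hα₁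
    have hαr : 1 ≤ α * r := (div_le_iff₀ hr0).1 hα₁
    rw [div_lt_iff₀ hr0] at h
    -- an exponent slightly smaller than `1 / r`
    obtain ⟨γ, hγ, hγr, hγp⟩ : ∃ γ : ℝ, 1 / 2 ≤ γ ∧ γ < 1 / r ∧ d * (1 - γ) < p := by
      have h1 : 1 / 2 < 1 / r := one_div_lt_one_div_of_lt hr0 hr₂
      have h2 : 1 - p / d < 1 / r := by
        rw [sub_lt_comm, lt_div_iff₀ hd0]
        have : (1 - 1 / r) * d * r = d * (r - 1) := by
          field_simp
        nlinarith
      obtain ⟨γ, hγ₁, hγ₂⟩ := exists_between (max_lt h1 h2)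
      refine ⟨γ, ((le_max_left _ _).trans_lt hγ₁).le, hγ₂, ?_⟩
      have h3 := (le_max_right _ _).trans_lt hγ₁
      rw [sub_lt_comm, lt_div_iff₀ hd0] at h3
      linarith
    have hγ1 : γ ≤ 1 := by
      have : 1 / r ≤ 1 := by
        rw [div_le_one hr0]
        exact hr₁.le
      linarith
    refine tsum_rpow_mul_measure_lt_maxWassersteinPow_lt_top hmeas hindep hlaw hd hp hr₁.le hr₂ hα0
      hαr hx hint (t := fun n => (n : ℝ) ^ α * x)
      (Filter.Eventually.of_forall fun n => (mul_comm _ _).le) ?_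
    filter_upwards [eventually_integral_deviationNorm_le hmeas hindep hlaw hp hr0 hαr hint hγ hγ1
      ((lt_div_iff₀ hr0).1 hγr) hγp (show 0 < x / (8 * K) by positivity)] with n hn N
    calc _ ≤ K * (x / (8 * K) * (n : ℝ) ^ α) := mul_le_mul_of_nonneg_left (hn N) hK0.le
      _ = _ := by field_simp
  · obtain ⟨hpd, hβr⟩ := hlow h
    have hβ0 : 0 < (d - p) / (d : ℝ) := div_pos (by linarith) hd0
    have hαr : 1 ≤ α * r := hβr.le.trans (by gcongr)
    obtain ⟨C, hC0, hC⟩ := exists_integral_deviationNorm_le hmeas hindep hlaw (by linarith) hpd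
      hint hβr
    have hmain := tsum_rpow_mul_measure_lt_maxWassersteinPow_lt_top hmeas hindep hlaw hd hp hr₁.le
      hr₂ (hβ0.trans hα₁) hαr hx hint (t := fun n => (n : ℝ) ^ α * x)
      (Filter.Eventually.of_forall fun n => (mul_comm _ _).le) (by
        filter_upwards [eventually_const_mul_rpow_le hα₁ C
          (show 0 < x / (8 * K) by positivity)] with n hn N
        calc _ ≤ K * (x / (8 * K) * (n : ℝ) ^ α) :=
              mul_le_mul_of_nonneg_left ((hC n N _).trans hn) hK0.le
          _ = _ := by field_simp)
    refine lt_of_le_of_lt (ENNReal.tsum_le_tsum fun n => mul_le_mul_left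
      (ENNReal.ofReal_le_ofReal (Real.rpow_le_rpow_of_exponent_le ?_ ?_)) _) hmain
    · exact_mod_cast n.pos
    · have e : (p * r - (1 - α) * r * d - d) / d = α * r - 1 - (d - p) / d * r := by
        field_simp
        ring
      rw [e]
      linarith
  · obtain ⟨hpd, hβr⟩ := hlow h
    have hβ0 : 0 < (d - p) / (d : ℝ) := div_pos (by linarith) hd0
    obtain ⟨C, hC0, hC⟩ := exists_integral_deviationNorm_le hmeas hindep hlaw (by linarith) hpd
      hint hβr
    have hlog : Filter.Tendsto (fun n : ℕ => Real.log n ^ (1 / r)) Filter.atTop Filter.atTop :=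
      (tendsto_rpow_atTop (by positivity)).comp
        (Real.tendsto_log_atTop.comp tendsto_natCast_atTop_atTop)
    have hmain := tsum_rpow_mul_measure_lt_maxWassersteinPow_lt_top hmeas hindep hlaw hd hp hr₁.le
      hr₂ hβ0 hβr.le hx hint
      (t := fun n => (n : ℝ) ^ ((d - p) / (d : ℝ)) * Real.log n ^ (1 / r) * x)
      (by
        filter_upwards [hlog.eventually_ge_atTop 1] with n hn
        calc x * (n : ℝ) ^ ((d - p) / (d : ℝ)) = (n : ℝ) ^ ((d - p) / (d : ℝ)) * 1 * x := by ring
          _ ≤ _ := by gcongr)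
      (by
        filter_upwards [hlog.eventually_ge_atTop (8 * K * C / x)] with n hn N
        rw [div_le_iff₀ hx] at hn
        calc _ ≤ K * (C * (n : ℝ) ^ ((d - p) / (d : ℝ))) :=
              mul_le_mul_of_nonneg_left (hC n N _) hK0.le
          _ = (n : ℝ) ^ ((d - p) / (d : ℝ)) * (8 * K * C) / 8 := by ring
          _ ≤ (n : ℝ) ^ ((d - p) / (d : ℝ)) * (Real.log n ^ (1 / r) * x) / 8 := by gcongr
          _ = _ := by ring)
    refine lt_of_le_of_lt (ENNReal.tsum_le_tsum fun n => mul_le_mul_left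
      (ENNReal.ofReal_le_ofReal ?_) _) hmain
    rw [one_div, ← Real.rpow_neg_one]
    refine Real.rpow_le_rpow_of_exponent_le ?_ ?_
    · exact_mod_cast n.pos
    · linarith
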